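/- \textbf{Setting.} Let $X$ be a second-countable locally compact Hausdorff space and $\mathfrak M^+$ the cone of all positive Radon measures on $X$. Let $\kappa:X\times X\to[0,\infty]$ be a symmetric lower semicontinuous kernel; put $U^\mu(x):=\int\kappa(x,y)\,d\mu(y)$, $I(\mu,\nu):=\int\kappa\,d(\mu\otimes\nu)$, $I(\mu):=I(\mu,\mu)$, and $\mathcal E^+:=\{\mu\in\mathfrak M^+:\ I(\mu)<\infty\}$. Assume that $\kappa$ satisfies: \begin{itemize} \item the energy principle: $I(\sigma)\ge 0$ for every signed Radon measure $\sigma$ on $X$ for which $I(\sigma)$ is well defined, and $I(\sigma)=0$ only for $\sigma=0$; thus $\|\mu-\nu\|:=\sqrt{I(\mu-\nu)}$ is a metric on $\mathcal E^+$, whose topology is called strong; \item the consistency principle: $\mathcal E^+$ is complete in the strong metric, and the strong topology on $\mathcal E^+$ is finer than the vague one (the topology of convergence of integrals of continuous functions with compact support); \item the domination principle: if $\mu\in\mathcal E^+$, $\nu\in\mathfrak M^+$ and $U^\mu\le U^\nu$ $\mu$-a.e., then $U^\mu\le U^\nu$ on $X$; \item the Ugaheri maximum principle: there is $M\in[1,\infty)$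 such that, whenever $\mu\in\mathcal E^+$, $c\in(0,\infty)$ and $U^\mu\le c$ $\mu$-a.e., then $U^\mu\le Mc$ on $X$. \end{itemize} For compact $K\subset X$ let $c(K):=1/\inf I(\mu)$, the infimum being over the positive measures $\mu$ of total mass $1$ concentrated on $K$; for $A\subset X$ let $c_*(A):=\sup\{c(K):K\subset A\text{ compact}\}$ and $c^*(A):=\inf\{c_*(G):G\supset A\text{ open}\}$. A property holds n.e. (resp. q.e.) on $A$ if the set of points of $A$ where it fails has $c_*$ (resp. $c^*$) equal to zero. A set $A$ is quasiclosed if $\inf\{c^*(A\bigtriangleup F):F\text{ closed}\}=0$. Let $\mathcal E^+(A)$ be the set of all $\mu\in\mathcal E^+$ for which $X\setminus A$ is $\mu$-negligible. An inner balayage $\omega^A$ of $\omega\in\mathfrak M^+$ onto $A$ is a measure in $\mathcal E^+(A)$ with $U^{\omega^A}=U^\omega$ n.e. on $A$. \textbf{Proposition.} Let $(A_j)_{j\in\mathbb N}$ be a decreasing sequence of quasiclosed subsets of $X$ whose intersection $A$ satisfies $c_*(A)>0$, and let $\omega\in\mathfrak M^+$, $\omega\neq0$, be such that either $\omega\in\mathcal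 E^+$, or the following hold, where $A_1$ denotes the first (largest) set of the sequence: (a) $\omega(X)<\infty$; (b) $U^\omega|_K$ is upper semicontinuous for every compact $K\subset A_1$; (c) $U^\omega$ is bounded on $A_1$. Then the inner balayages $\omega^{A_j}$, $j\in\mathbb N$, and $\omega^A$ exist and are unique, and \[\omega^{A_j}\to\omega^A\quad\text{strongly and vaguely in }\mathcal E^+,\] \[U^{\omega^{A_j}}\downarrow U^{\omega^A}\quad\text{pointwise q.e. on }X,\] that is, for quasi-every $x\in X$ the sequence $U^{\omega^{A_j}}(x)$ is decreasing and converges to $U^{\omega^A}(x)$. -/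

import Mathlib

open MeasureTheory Filter Topology
open scoped ENNReal NNReal

namespace Balayage

/-! Potential theory with respect to a kernel on a second-countable locally compact Hausdorff
space `X` with its Borel σ-algebra. On such a space the positive Radon measures are exactly the
locally finite Borel measures, and every real-valued Radon measure is a difference `μ - ν` of two
of them. -/

section Basic

variable {X : Type*} [MeasurableSpace X]

/-- The potential `U^μ(x) = ∫ κ(x, y) dμ(y)` of a positive measure. -/
noncomputable def potential (κ : X → X → ℝ≥0∞) (μ : Measure X) (x : X) : ℝ≥0∞ :=
  ∫⁻ y, κ x y ∂μ

/-- The mutual energy `I(μ, ν) = ∫ κ d(μ ⊗ ν)` of two positive measures. -/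
noncomputable def mutualEnergy (κ : X → X → ℝ≥0∞) (μ ν : Measure X) : ℝ≥0∞ :=
  ∫⁻ p, κ p.1 p.2 ∂(μ.prod ν)

/-- The energy `I(μ) = I(μ, μ)` of a positive measure. -/
noncomputable def energy (κ : X → X → ℝ≥0∞) (μ : Measure X) : ℝ≥0∞ :=
  mutualEnergy κ μ μ

/-- The strong distance `‖μ - ν‖`, where `‖μ - ν‖² = I(μ - ν) = I(μ) + I(ν) - 2 I(μ, ν)`
for positive measures `μ`, `ν` of finite energy. -/
noncomputable def strongDist (κ : X → X → ℝ≥0∞) (μ ν : Measure X) : ℝ :=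
  Real.sqrt ((energy κ μ).toReal + (energy κ ν).toReal - 2 * (mutualEnergy κ μ ν).toReal)

/-- Strong convergence of a sequence of positive measures of finite energy. -/
def StrongTendsto (κ : X → X → ℝ≥0∞) (μ : ℕ → Measure X) (ν : Measure X) : Prop :=
  Tendsto (fun j => strongDist κ (μ j) ν) atTop (𝓝 0)

/-- Strong Cauchy sequences of positive measures of finite energy. -/
def StrongCauchy (κ : X → X → ℝ≥0∞) (μ : ℕ → Measure X) : Prop :=
  ∀ ε : ℝ, 0 < ε → ∃ N : ℕ, ∀ m ≥ N, ∀ n ≥ N, strongDist κ (μ m) (μ n) < ε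

end Basic

section Topological

variable {X : Type*} [TopologicalSpace X] [MeasurableSpace X]

/-- Vague convergence of a sequence of positive Radon measures: convergence of the integrals of
all continuous functions of compact support. -/
def VagueTendsto (μ : ℕ → Measure X) (ν : Measure X) : Prop :=
  ∀ φ : X → ℝ, Continuous φ → HasCompactSupport φ →
    Tendsto (fun j => ∫ x, φ x ∂(μ j)) atTop (𝓝 (∫ x, φ x ∂ν))

/-- The cone `𝓔⁺` of all positive Radon measures of finite energy. -/
structure MemEPlus (κ : X → X → ℝ≥0∞) (μ : Measure X) : Prop where
  locallyFinite : IsLocallyFiniteMeasure μ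
  energy_lt_top : energy κ μ < ∞

/-- The cone `𝓔⁺(A)` of all `μ ∈ 𝓔⁺` concentrated on `A`, that is, such that `X \ A` is
`μ`-negligible. -/
structure MemEPlusOn (κ : X → X → ℝ≥0∞) (A : Set X) (μ : Measure X) : Prop where
  mem : MemEPlus κ μ
  concentrated : μ Aᶜ = 0

/-- The energy principle (strict positive definiteness): `I(σ) ≥ 0` for every signed Radon
measure `σ` whose energy is well defined, and `I(σ) = 0` only for `σ = 0`.
Here `σ = μ - ν` and `I(σ) = I(μ) + I(ν) - 2 I(μ, ν)`. -/
def EnergyPrinciple (κ : X → X → ℝ≥0∞) : Prop :=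
  ∀ μ ν : Measure X, IsLocallyFiniteMeasure μ → IsLocallyFiniteMeasure ν →
    2 * mutualEnergy κ μ ν ≤ energy κ μ + energy κ ν ∧
    (energy κ μ + energy κ ν < ∞ →
      energy κ μ + energy κ ν = 2 * mutualEnergy κ μ ν → μ = ν)

/-- The consistency principle: `𝓔⁺` is strongly complete, and the strong topology on `𝓔⁺` is
finer than the vague topology. The strong topology being given by a metric, both conditions are
expressed by sequences. -/
def ConsistencyPrinciple (κ : X → X → ℝ≥0∞) : Prop :=
  (∀ μ : ℕ → Measure X, (∀ j, MemEPlus κ (μ j)) → StrongCauchy κ μ →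
    ∃ ν : Measure X, MemEPlus κ ν ∧ StrongTendsto κ μ ν) ∧
  (∀ (μ : ℕ → Measure X) (ν : Measure X), (∀ j, MemEPlus κ (μ j)) → MemEPlus κ ν →
    StrongTendsto κ μ ν → VagueTendsto μ ν)

/-- The domination principle. -/
def DominationPrinciple (κ : X → X → ℝ≥0∞) : Prop :=
  ∀ μ ν : Measure X, MemEPlus κ μ → IsLocallyFiniteMeasure ν →
    (∀ᵐ x ∂μ, potential κ μ x ≤ potential κ ν x) →
    ∀ x, potential κ μ x ≤ potential κ ν x

/-- The Ugaheri maximum principle. -/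
def UgaheriPrinciple (κ : X → X → ℝ≥0∞) : Prop :=
  ∃ M : ℝ≥0, 1 ≤ M ∧ ∀ (μ : Measure X) (c : ℝ≥0), MemEPlus κ μ → 0 < c →
    (∀ᵐ x ∂μ, potential κ μ x ≤ c) → ∀ x, potential κ μ x ≤ M * c

/-- The standing assumptions on the kernel: a symmetric lower semicontinuous function
`κ : X × X → [0, ∞]` satisfying the energy, consistency, domination and Ugaheri maximum
principles. -/
structure IsAdmissibleKernel (κ : X → X → ℝ≥0∞) : Prop where
  symm : ∀ x y, κ x y = κ y x
  lsc : LowerSemicontinuous (fun p : X × X => κ p.1 p.2)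
  energyPrinciple : EnergyPrinciple κ
  consistency : ConsistencyPrinciple κ
  domination : DominationPrinciple κ
  ugaheri : UgaheriPrinciple κ

/-- The capacity `c(K) = 1 / w(K)` of a compact set `K`, where `w(K)` is the infimum of the
energy over the positive measures of total mass one concentrated on `K`. -/
noncomputable def compactCap (κ : X → X → ℝ≥0∞) (K : Set X) : ℝ≥0∞ :=
  (⨅ (μ : Measure X) (_ : μ Set.univ = 1) (_ : μ Kᶜ = 0), energy κ μ)⁻¹

/-- The inner capacity `c_*(A) = sup {c(K) : K ⊆ A compact}`. -/
noncomputable def innerCap (κ : X → X → ℝ≥0∞) (A : Set X) : ℝ≥0∞ :=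
  ⨆ (K : Set X) (_ : IsCompact K) (_ : K ⊆ A), compactCap κ K

/-- The outer capacity `c^*(A) = inf {c_*(G) : G ⊇ A open}`. -/
noncomputable def outerCap (κ : X → X → ℝ≥0∞) (A : Set X) : ℝ≥0∞ :=
  ⨅ (G : Set X) (_ : IsOpen G) (_ : A ⊆ G), innerCap κ G

/-- `P` holds nearly everywhere (n.e.) on `A`. -/
def NearlyEverywhereOn (κ : X → X → ℝ≥0∞) (A : Set X) (P : X → Prop) : Prop :=
  innerCap κ {x ∈ A | ¬ P x} = 0

/-- `P` holds quasi-everywhere (q.e.) on `A`. -/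
def QuasiEverywhereOn (κ : X → X → ℝ≥0∞) (A : Set X) (P : X → Prop) : Prop :=
  outerCap κ {x ∈ A | ¬ P x} = 0

/-- `A` is quasiclosed: `inf {c^*(A △ F) : F closed} = 0`. -/
def IsQuasiclosed (κ : X → X → ℝ≥0∞) (A : Set X) : Prop :=
  ⨅ (F : Set X) (_ : IsClosed F), outerCap κ (symmDiff A F) = 0

/-- The conditions (a)-(c) on `ω` and `A`: `ω` is bounded, the restriction of `U^ω` to every
compact subset of `A` is upper semicontinuous, and `U^ω` is bounded on `A`. -/
structure BoundedFieldOn (κ : X → X → ℝ≥0∞) (ω : Measure X) (A : Set X) : Prop where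
  bounded : ω Set.univ < ∞
  usc : ∀ K : Set X, IsCompact K → K ⊆ A → UpperSemicontinuousOn (potential κ ω) K
  bounded_potential : ∃ C : ℝ≥0, ∀ x ∈ A, potential κ ω x ≤ C

/-- `ν` is an inner balayage of `ω` onto `A`: `ν ∈ 𝓔⁺(A)` and `U^ν = U^ω` n.e. on `A`. -/
structure IsInnerBalayage (κ : X → X → ℝ≥0∞) (ω : Measure X) (A : Set X)
    (ν : Measure X) : Prop where
  mem : MemEPlusOn κ A ν
  potential_eq : NearlyEverywhereOn κ A (fun x => potential κ ν x = potential κ ω x)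

end Topological

end Balayage

set_option linter.unusedSectionVars false

namespace Balayage

variable {X : Type*} [TopologicalSpace X] [T2Space X] [LocallyCompactSpace X]
  [SecondCountableTopology X] [MeasurableSpace X] [BorelSpace X] {κ : X → X → ℝ≥0∞}

/-! ### Potentials and mutual energies of positive measures. -/

section Potential

/-! Everything reduces to balayage of a measure `ω'` of finite energy. If `ω` itself has infinite
energy, `BoundedFieldOn.exists_memEPlus` supplies `ω'` as a strong limit of measures on compact
subsets of the largest set. The Ugaheri principle, applied to equilibrium measures, bounds the
energies involved.

Quasiclosed sets enter through the estimate `μ E ≤ c_*(E)^(1/2) ‖μ‖` (`measure_le_innerCap_mul`). It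
makes them null measurable for measures of finite energy and makes the cones `𝓔⁺(A j)` strongly
closed; both properties pass to the intersection. A Gauss variational problem on a strongly closed
cone is then solvable by completeness. Its minimizer is the balayage: the variational inequality
gives one bound for the potentials, the domination principle the other (`exists_balayage`).

Balayages act as orthogonal projections of `ω'`: for nested sets, the squared distance is the
difference of the energies. The energies decrease, so the sequence is Cauchy, and testing against
`𝓔⁺(⋂ j, A j)` identifies its limit (`strongTendsto_isBalayage`). Domination orders the potentials
everywhere.

For q.e. convergence, suppose that the potentials stay above the limit potential by `t` on a set of
positive outer capacity. Probability measures of bounded energy on shrinking open neighbourhoods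
then converge strongly to some `σ`, and integration against `σ` contradicts strong convergence
(`outerCap_forall_add_lt_eq_zero`). -/

theorem measurable_kernel (hκ : IsAdmissibleKernel κ) :
    Measurable (fun p : X × X => κ p.1 p.2) :=
  hκ.lsc.measurable

theorem measurable_kernel_right (hκ : IsAdmissibleKernel κ) (x : X) : Measurable (κ x) :=
  (measurable_kernel hκ).comp measurable_prodMk_left

/-- Fatou's lemma along the neighbourhood filter, which is countably generated in a second-countable
space. -/
theorem lowerSemicontinuous_potential (hκ : IsAdmissibleKernel κ) (μ : Measure X) :
    LowerSemicontinuous (potential κ μ) := by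
  refine fun x => lowerSemicontinuousAt_iff_le_liminf.2 ?_
  calc potential κ μ x ≤ ∫⁻ y, liminf (fun x' => κ x' y) (𝓝 x) ∂μ := by
        refine lintegral_mono fun y => ?_
        have h : LowerSemicontinuous fun x' => κ x' y :=
          hκ.lsc.comp (g := fun x' => (x', y)) (by fun_prop)
        exact lowerSemicontinuousAt_iff_le_liminf.1 (h x)
    _ ≤ _ := lintegral_liminf_le fun x' => measurable_kernel_right hκ x'

theorem measurable_potential (hκ : IsAdmissibleKernel κ) (μ : Measure X) :
    Measurable (potential κ μ) :=
  (lowerSemicontinuous_potential hκ μ).measurable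

theorem mutualEnergy_eq_lintegral (hκ : IsAdmissibleKernel κ) (μ ν : Measure X) [SFinite ν] :
    mutualEnergy κ μ ν = ∫⁻ x, potential κ ν x ∂μ :=
  lintegral_prod _ (measurable_kernel hκ).aemeasurable

theorem mutualEnergy_comm (hκ : IsAdmissibleKernel κ) (μ ν : Measure X) [SFinite μ] [SFinite ν] :
    mutualEnergy κ μ ν = mutualEnergy κ ν μ := by
  rw [mutualEnergy, lintegral_prod_symm' _ (measurable_kernel hκ), mutualEnergy,
    lintegral_prod _ (measurable_kernel hκ).aemeasurable]
  simp_rw [hκ.symm]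

theorem mutualEnergy_add_left (hκ : IsAdmissibleKernel κ) (μ μ' ν : Measure X) [SFinite ν] :
    mutualEnergy κ (μ + μ') ν = mutualEnergy κ μ ν + mutualEnergy κ μ' ν := by
  simp only [mutualEnergy_eq_lintegral hκ, lintegral_add_measure]

theorem mutualEnergy_smul_left (hκ : IsAdmissibleKernel κ) (c : ℝ≥0) (μ ν : Measure X)
    [SFinite ν] : mutualEnergy κ (c • μ) ν = c * mutualEnergy κ μ ν := by
  simp only [mutualEnergy_eq_lintegral hκ, lintegral_smul_measure]
  rfl

theorem potential_add (μ ν : Measure X) (x : X) :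
    potential κ (μ + ν) x = potential κ μ x + potential κ ν x :=
  lintegral_add_measure ..

theorem potential_smul (c : ℝ≥0) (μ : Measure X) (x : X) :
    potential κ (c • μ) x = c * potential κ μ x :=
  lintegral_smul_measure ..

theorem mutualEnergy_mono (hκ : IsAdmissibleKernel κ) {μ μ' ν ν' : Measure X} [SFinite ν]
    [SFinite ν'] (hμ : μ ≤ μ') (hν : ν ≤ ν') : mutualEnergy κ μ ν ≤ mutualEnergy κ μ' ν' := by
  rw [mutualEnergy_eq_lintegral hκ, mutualEnergy_eq_lintegral hκ]
  exact lintegral_mono' hμ fun x => lintegral_mono' hν le_rfl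

end Potential

theorem isLocallyFiniteMeasure_add (μ ν : Measure X) [IsLocallyFiniteMeasure μ]
    [IsLocallyFiniteMeasure ν] : IsLocallyFiniteMeasure (μ + ν) := by
  refine ⟨fun x => ?_⟩
  obtain ⟨s, hs, hs'⟩ := μ.finiteAt_nhds x
  obtain ⟨t, ht, ht'⟩ := ν.finiteAt_nhds x
  refine ⟨s ∩ t, inter_mem hs ht, ?_⟩
  rw [Measure.add_apply]
  exact ENNReal.add_lt_top.2 ⟨(measure_mono Set.inter_subset_left).trans_lt hs',
    (measure_mono Set.inter_subset_right).trans_lt ht'⟩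

/-! ### The pre-Hilbert structure of measures of finite energy. -/

section Energy

/-- The mutual energy of two measures of finite energy, as a real number. -/
noncomputable def pairing (κ : X → X → ℝ≥0∞) (μ ν : Measure X) : ℝ :=
  (mutualEnergy κ μ ν).toReal

theorem pairing_nonneg (μ ν : Measure X) : 0 ≤ pairing κ μ ν := ENNReal.toReal_nonneg

variable {μ ν σ τ : Measure X}

theorem mutualEnergy_lt_top (hκ : IsAdmissibleKernel κ) (hμ : MemEPlus κ μ)
    (hν : MemEPlus κ ν) : mutualEnergy κ μ ν < ∞ := by
  have h := (hκ.energyPrinciple μ ν hμ.1 hν.1).1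
  have h2 : 2 * mutualEnergy κ μ ν < ∞ :=
    h.trans_lt (ENNReal.add_lt_top.2 ⟨hμ.2, hν.2⟩)
  refine lt_of_le_of_lt ?_ h2
  rw [two_mul]
  exact le_self_add

theorem pairing_comm (hκ : IsAdmissibleKernel κ) (hμ : MemEPlus κ μ) (hν : MemEPlus κ ν) :
    pairing κ μ ν = pairing κ ν μ := by
  have := hμ.1; have := hν.1
  rw [pairing, mutualEnergy_comm hκ, pairing]

theorem MemEPlus.smul (hκ : IsAdmissibleKernel κ) (hμ : MemEPlus κ μ) (c : ℝ≥0) :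
    MemEPlus κ (c • μ) := by
  have := hμ.1
  refine ⟨inferInstance, ?_⟩
  rw [energy, mutualEnergy_smul_left hκ, mutualEnergy_comm hκ, mutualEnergy_smul_left hκ]
  exact ENNReal.mul_lt_top ENNReal.coe_lt_top (ENNReal.mul_lt_top ENNReal.coe_lt_top hμ.2)

theorem MemEPlus.add (hκ : IsAdmissibleKernel κ) (hμ : MemEPlus κ μ) (hν : MemEPlus κ ν) :
    MemEPlus κ (μ + ν) := by
  have := hμ.1; have := hν.1
  have := isLocallyFiniteMeasure_add μ ν
  refine ⟨inferInstance, ?_⟩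
  rw [energy, mutualEnergy_add_left hκ, mutualEnergy_comm hκ μ, mutualEnergy_comm hκ ν,
    mutualEnergy_add_left hκ, mutualEnergy_add_left hκ]
  simp only [ENNReal.add_lt_top]
  exact ⟨⟨mutualEnergy_lt_top hκ hμ hμ, mutualEnergy_lt_top hκ hν hμ⟩,
    mutualEnergy_lt_top hκ hμ hν, mutualEnergy_lt_top hκ hν hν⟩

theorem MemEPlus.of_le (hκ : IsAdmissibleKernel κ) (hμ : MemEPlus κ μ) (h : ν ≤ μ) :
    MemEPlus κ ν := by
  have := hμ.1
  have : IsLocallyFiniteMeasure ν := Measure.isLocallyFiniteMeasure_of_le h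
  exact ⟨inferInstance, (mutualEnergy_mono hκ h h).trans_lt hμ.2⟩

theorem MemEPlus.restrict (hκ : IsAdmissibleKernel κ) (hμ : MemEPlus κ μ) (s : Set X) :
    MemEPlus κ (μ.restrict s) :=
  hμ.of_le hκ Measure.restrict_le_self

theorem MemEPlus.zero : MemEPlus κ (0 : Measure X) :=
  ⟨inferInstance, by simp [energy, mutualEnergy]⟩

theorem pairing_add_left (hκ : IsAdmissibleKernel κ) (hμ : MemEPlus κ μ) (hν : MemEPlus κ ν)
    (hσ : MemEPlus κ σ) : pairing κ (μ + ν) σ = pairing κ μ σ + pairing κ ν σ := by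
  have := hσ.1
  rw [pairing, mutualEnergy_add_left hκ, ENNReal.toReal_add (mutualEnergy_lt_top hκ hμ hσ).ne
    (mutualEnergy_lt_top hκ hν hσ).ne, pairing, pairing]

theorem pairing_add_right (hκ : IsAdmissibleKernel κ) (hμ : MemEPlus κ μ) (hν : MemEPlus κ ν)
    (hσ : MemEPlus κ σ) : pairing κ σ (μ + ν) = pairing κ σ μ + pairing κ σ ν := by
  rw [pairing_comm hκ hσ (hμ.add hκ hν), pairing_add_left hκ hμ hν hσ, pairing_comm hκ hσ hμ,
    pairing_comm hκ hσ hν]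

theorem pairing_smul_left (hκ : IsAdmissibleKernel κ) (c : ℝ≥0) (hσ : MemEPlus κ σ) :
    pairing κ (c • μ) σ = c * pairing κ μ σ := by
  have := hσ.1
  rw [pairing, mutualEnergy_smul_left hκ, ENNReal.toReal_mul, pairing, ENNReal.coe_toReal]

theorem pairing_smul_right (hκ : IsAdmissibleKernel κ) (c : ℝ≥0) (hμ : MemEPlus κ μ)
    (hσ : MemEPlus κ σ) : pairing κ σ (c • μ) = c * pairing κ σ μ := by
  rw [pairing_comm hκ hσ (hμ.smul hκ c), pairing_smul_left hκ c hσ, pairing_comm hκ hμ hσ]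

theorem two_mul_pairing_le (hκ : IsAdmissibleKernel κ) (hμ : MemEPlus κ μ) (hν : MemEPlus κ ν) :
    2 * pairing κ μ ν ≤ pairing κ μ μ + pairing κ ν ν := by
  have h := (hκ.energyPrinciple μ ν hμ.1 hν.1).1
  have h' := ENNReal.toReal_mono (ENNReal.add_lt_top.2 ⟨hμ.2, hν.2⟩).ne h
  rwa [ENNReal.toReal_add hμ.2.ne hν.2.ne, ENNReal.toReal_mul] at h'

theorem strongDist_sq (hκ : IsAdmissibleKernel κ) (hμ : MemEPlus κ μ) (hν : MemEPlus κ ν) :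
    strongDist κ μ ν ^ 2 = pairing κ μ μ + pairing κ ν ν - 2 * pairing κ μ ν :=
  Real.sq_sqrt (sub_nonneg.2 (two_mul_pairing_le hκ hμ hν))

theorem strongDist_nonneg : 0 ≤ strongDist κ μ ν := Real.sqrt_nonneg _

theorem eq_of_strongDist_sq_eq_zero (hκ : IsAdmissibleKernel κ) (hμ : MemEPlus κ μ)
    (hν : MemEPlus κ ν) (h : pairing κ μ μ + pairing κ ν ν = 2 * pairing κ μ ν) : μ = ν := by
  refine (hκ.energyPrinciple μ ν hμ.1 hν.1).2 (ENNReal.add_lt_top.2 ⟨hμ.2, hν.2⟩) ?_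
  rw [← ENNReal.toReal_eq_toReal_iff' (ENNReal.add_lt_top.2 ⟨hμ.2, hν.2⟩).ne
    (ENNReal.mul_lt_top ENNReal.ofNat_lt_top (mutualEnergy_lt_top hκ hμ hν)).ne,
    ENNReal.toReal_add hμ.2.ne hν.2.ne, ENNReal.toReal_mul]
  exact h

/-- The Cauchy-Schwarz inequality. -/
theorem pairing_sub_sq_le (hκ : IsAdmissibleKernel κ) (hσ : MemEPlus κ σ) (hμ : MemEPlus κ μ)
    (hν : MemEPlus κ ν) :
    (pairing κ σ μ - pairing κ σ ν) ^ 2 ≤ pairing κ σ σ * strongDist κ μ ν ^ 2 := by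
  -- This is `I(σ + sμ - sν) ≥ 0`, split into the positive measures `σ + sμ` and `sν`. Negative `s`
  -- is obtained by exchanging `μ` and `ν`, after which the discriminant applies.
  have key : ∀ {μ ν : Measure X}, MemEPlus κ μ → MemEPlus κ ν → ∀ s : ℝ≥0,
      0 ≤ strongDist κ μ ν ^ 2 * ((s : ℝ) * s)
        + 2 * (pairing κ σ μ - pairing κ σ ν) * s + pairing κ σ σ := by
    intro μ ν hμ hν s
    have hsμ := hμ.smul hκ s
    have hsν := hν.smul hκ s
    have h := two_mul_pairing_le hκ (hσ.add hκ hsμ) hsν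
    rw [pairing_add_left hκ hσ hsμ hsν, pairing_add_left hκ hσ hsμ (hσ.add hκ hsμ),
      pairing_add_right hκ hσ hsμ hσ, pairing_add_right hκ hσ hsμ hsμ,
      pairing_smul_right hκ s hν hσ, pairing_smul_right hκ s hμ hσ,
      pairing_smul_left hκ s hσ, pairing_smul_left hκ s hsμ, pairing_smul_left hκ s hsν,
      pairing_smul_left hκ s hsν, pairing_smul_right hκ s hν hμ, pairing_smul_right hκ s hν hν,
      pairing_smul_right hκ s hμ hμ, pairing_comm hκ hμ hσ] at h
    rw [strongDist_sq hκ hμ hν]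
    linarith
  have hdisc : discrim (strongDist κ μ ν ^ 2) (2 * (pairing κ σ μ - pairing κ σ ν))
      (pairing κ σ σ) ≤ 0 := by
    refine discrim_le_zero fun s => ?_
    rcases le_total 0 s with hs | hs
    · exact key hμ hν ⟨s, hs⟩
    · obtain ⟨r, hr⟩ : ∃ r : ℝ≥0, (r : ℝ) = -s := ⟨⟨-s, neg_nonneg.2 hs⟩, rfl⟩
      have h := key hν hμ r
      rw [strongDist_sq hκ hν hμ, pairing_comm hκ hν hμ] at h
      rw [strongDist_sq hκ hμ hν]
      rw [hr] at h
      linarith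
  rw [discrim] at hdisc
  linarith

theorem pairing_sq_le (hκ : IsAdmissibleKernel κ) (hμ : MemEPlus κ μ) (hν : MemEPlus κ ν) :
    pairing κ μ ν ^ 2 ≤ pairing κ μ μ * pairing κ ν ν := by
  have h := pairing_sub_sq_le hκ hμ hν (MemEPlus.zero (κ := κ))
  rw [strongDist_sq hκ hν MemEPlus.zero] at h
  have h0 : ∀ ρ : Measure X, pairing κ ρ 0 = 0 := fun ρ => by simp [pairing, mutualEnergy]
  simpa [h0] using h

theorem StrongTendsto.pairing_left (hκ : IsAdmissibleKernel κ) {μ : ℕ → Measure X}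
    (hμ : ∀ n, MemEPlus κ (μ n)) (hν : MemEPlus κ ν) (h : StrongTendsto κ μ ν)
    (hσ : MemEPlus κ σ) :
    Tendsto (fun n => pairing κ σ (μ n)) atTop (𝓝 (pairing κ σ ν)) := by
  rw [← tendsto_sub_nhds_zero_iff]
  refine squeeze_zero_norm (a := fun n => √(pairing κ σ σ) * strongDist κ (μ n) ν)
    (fun n => ?_) ?_
  · rw [Real.norm_eq_abs]
    refine abs_le_of_sq_le_sq ?_ (mul_nonneg (Real.sqrt_nonneg _) strongDist_nonneg)
    rw [mul_pow, Real.sq_sqrt (pairing_nonneg _ _)]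
    exact pairing_sub_sq_le hκ hσ (hμ n) hν
  · simpa using h.const_mul (√(pairing κ σ σ))

theorem StrongTendsto.pairing_self (hκ : IsAdmissibleKernel κ) {μ : ℕ → Measure X}
    (hμ : ∀ n, MemEPlus κ (μ n)) (hν : MemEPlus κ ν) (h : StrongTendsto κ μ ν) :
    Tendsto (fun n => pairing κ (μ n) (μ n)) atTop (𝓝 (pairing κ ν ν)) := by
  have h1 := h.pairing_left hκ hμ hν hν
  have h2 : Tendsto (fun n => strongDist κ (μ n) ν ^ 2) atTop (𝓝 (0 ^ 2)) := Tendsto.pow h 2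
  have h3 := (h2.add (h1.const_mul 2)).sub (tendsto_const_nhds (x := pairing κ ν ν))
  have e : ∀ n, strongDist κ (μ n) ν ^ 2 + 2 * pairing κ ν (μ n) - pairing κ ν ν
      = pairing κ (μ n) (μ n) := fun n => by
    rw [strongDist_sq hκ (hμ n) hν, pairing_comm hκ (hμ n) hν]; ring
  simp only [e] at h3
  convert h3 using 2
  ring

end Energy

/-! ### Minimizing sequences in convex classes of measures. -/

section Minimization

variable {μ ν σ τ : Measure X}

/-- The midpoint of two measures. -/
noncomputable def midpointMeasure (μ ν : Measure X) : Measure X := (2⁻¹ : ℝ≥0) • (μ + ν)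

theorem MemEPlus.midpoint (hκ : IsAdmissibleKernel κ) (hμ : MemEPlus κ μ) (hν : MemEPlus κ ν) :
    MemEPlus κ (midpointMeasure μ ν) :=
  (hμ.add hκ hν).smul hκ _

theorem pairing_midpoint (hκ : IsAdmissibleKernel κ) (hμ : MemEPlus κ μ) (hν : MemEPlus κ ν) :
    strongDist κ μ ν ^ 2 = 2 * pairing κ μ μ + 2 * pairing κ ν ν
      - 4 * pairing κ (midpointMeasure μ ν) (midpointMeasure μ ν) := by
  have h := hμ.add hκ hν
  rw [strongDist_sq hκ hμ hν, midpointMeasure, pairing_smul_left hκ _ (h.smul hκ _),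
    pairing_smul_right hκ _ h h, pairing_add_left hκ hμ hν h, pairing_add_right hκ hμ hν hμ,
    pairing_add_right hκ hμ hν hν, pairing_comm hκ hν hμ]
  push_cast
  ring

/-- The Gauss functional associated with the external field functional `L`. -/
noncomputable def gaussFunctional (κ : X → X → ℝ≥0∞) (L : Measure X → ℝ) (μ : Measure X) : ℝ :=
  pairing κ μ μ - 2 * L μ

/-- Almost minimizing elements of a decreasing sequence of midpoint convex sets of measures of
finite energy converge strongly. -/
theorem exists_strongTendsto_of_antitone (hκ : IsAdmissibleKernel κ) (Γ : ℕ → Set (Measure X))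
    (hΓ : Antitone Γ) (hE : ∀ μ ∈ Γ 0, MemEPlus κ μ)
    (hmid : ∀ n, ∀ μ ∈ Γ n, ∀ ν ∈ Γ n, midpointMeasure μ ν ∈ Γ n) (L : Measure X → ℝ)
    (hL : ∀ μ ∈ Γ 0, ∀ ν ∈ Γ 0, L (midpointMeasure μ ν) = (L μ + L ν) / 2) (a b : ℝ)
    (ha : ∀ μ ∈ Γ 0, a ≤ gaussFunctional κ L μ)
    (hb : ∀ n, ∃ μ ∈ Γ n, gaussFunctional κ L μ ≤ b) :
    ∃ (τ : ℕ → Measure X) (ν : Measure X), (∀ n, τ n ∈ Γ n) ∧ MemEPlus κ ν ∧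
      StrongTendsto κ τ ν ∧
      ∀ n, ∀ μ ∈ Γ n, gaussFunctional κ L (τ n) ≤ gaussFunctional κ L μ + 1 / ((n : ℝ) + 1) := by
  set J := gaussFunctional κ L
  have hΓ0 : ∀ n, Γ n ⊆ Γ 0 := fun n => hΓ (Nat.zero_le n)
  set w : ℕ → ℝ := fun n => sInf (J '' Γ n)
  have hbdd : ∀ n, BddBelow (J '' Γ n) := fun n =>
    ⟨a, by rintro _ ⟨μ, hμ, rfl⟩; exact ha μ (hΓ0 n hμ)⟩
  have hwle : ∀ n, ∀ μ ∈ Γ n, w n ≤ J μ := fun n μ hμ => csInf_le (hbdd n) ⟨μ, hμ, rfl⟩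
  have hne : ∀ n, (J '' Γ n).Nonempty := fun n =>
    let ⟨μ, hμ, _⟩ := hb n
    ⟨_, μ, hμ, rfl⟩
  have hwmono : Monotone w := fun m n hmn =>
    csInf_le_csInf (hbdd m) (hne n) (Set.image_mono (hΓ hmn))
  have hwb : ∀ n, w n ≤ b := fun n =>
    let ⟨μ, hμ, h⟩ := hb n
    (hwle n μ hμ).trans h
  have hwlim : Tendsto w atTop (𝓝 (⨆ n, w n)) :=
    tendsto_atTop_ciSup hwmono ⟨b, by rintro _ ⟨n, rfl⟩; exact hwb n⟩
  have hwsup : ∀ n, w n ≤ ⨆ n, w n := hwmono.ge_of_tendsto hwlim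
  have hex : ∀ n, ∃ μ ∈ Γ n, J μ < w n + 1 / ((n : ℝ) + 1) := fun n => by
    obtain ⟨_, ⟨μ, hμ, rfl⟩, h⟩ :=
      exists_lt_of_csInf_lt (hne n) (lt_add_of_pos_right (w n) (Nat.one_div_pos_of_nat (n := n)))
    exact ⟨μ, hμ, h⟩
  choose τ hτ hJτ using hex
  have hτE : ∀ n, MemEPlus κ (τ n) := fun n => hE _ (hΓ0 n (hτ n))
  -- Parallelogram identity: the terms in `L` cancel because `L` is affine at midpoints, and the
  -- midpoint lies in `Γ N`, so its functional is at least `w N`.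
  have hdist : ∀ N, ∀ m ≥ N, ∀ n ≥ N,
      strongDist κ (τ m) (τ n) ^ 2 ≤ 4 * ((⨆ n, w n) - w N + 1 / ((N : ℝ) + 1)) := by
    intro N m hm n hn
    have hmid' := hwle N _ (hmid N _ (hΓ hm (hτ m)) _ (hΓ hn (hτ n)))
    have hLm := hL _ (hΓ0 m (hτ m)) _ (hΓ0 n (hτ n))
    have h1 := hJτ m
    have h2 := hJτ n
    have h3 := one_div_le_one_div_of_le (by positivity : (0 : ℝ) < (N : ℝ) + 1)
      (by gcongr : (N : ℝ) + 1 ≤ (m : ℝ) + 1)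
    have h4 := one_div_le_one_div_of_le (by positivity : (0 : ℝ) < (N : ℝ) + 1)
      (by gcongr : (N : ℝ) + 1 ≤ (n : ℝ) + 1)
    have h5 := hwsup m
    have h6 := hwsup n
    rw [pairing_midpoint hκ (hτE m) (hτE n)]
    simp only [J, gaussFunctional] at hmid' h1 h2
    rw [hLm] at hmid'
    linarith
  have hlim : Tendsto (fun N : ℕ => 4 * ((⨆ n, w n) - w N + 1 / ((N : ℝ) + 1))) atTop (𝓝 0) := by
    have := ((hwlim.const_sub (⨆ n, w n)).add tendsto_one_div_add_atTop_nhds_zero_nat).const_mul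
      (4 : ℝ)
    simpa using this
  have hcauchy : StrongCauchy κ τ := by
    intro ε hε
    obtain ⟨N, hN⟩ := (hlim.eventually (gt_mem_nhds (by positivity : 0 < ε ^ 2))).exists
    exact ⟨N, fun m hm n hn =>
      lt_of_pow_lt_pow_left₀ 2 hε.le ((hdist N m hm n hn).trans_lt hN)⟩
  obtain ⟨ν, hν, hlimν⟩ := hκ.consistency.1 τ hτE hcauchy
  exact ⟨τ, ν, hτ, hν, hlimν, fun n μ hμ =>
    (hJτ n).le.trans (by linarith [hwle n μ hμ])⟩

/-- The first-order condition at a minimum: the linear term dominates for small `s`. -/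
theorem nonneg_of_forall_quadratic {a c : ℝ} (hc : 0 ≤ c)
    (h : ∀ s : ℝ≥0, 0 < s → s ≤ 1 → 0 ≤ 2 * s * a + s ^ 2 * c) : 0 ≤ a := by
  by_contra! ha
  have hpos : 0 < c + 1 - a := by linarith
  -- The denominator keeps this value at most 1 and forces `s * c < -a`, hence `2 * a + s * c < 0`.
  have hs0 : 0 < -a / (c + 1 - a) := div_pos (by linarith) hpos
  set s := -a / (c + 1 - a)
  have hs : 0 ≤ 2 * s * a + s ^ 2 * c :=
    h ⟨s, hs0.le⟩ hs0 ((div_le_one hpos).2 (by linarith) : s ≤ (1 : ℝ))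
  have hsc : s * (c + 1 - a) = -a := div_mul_cancel₀ _ hpos.ne'
  have : s * (2 * a + s * c) < 0 := mul_neg_of_pos_of_neg hs0 (by nlinarith)
  nlinarith

end Minimization

/-! ### Gauss variational problems on strongly closed cones. -/

section Concentrated

variable {μ ν σ τ : Measure X} {A B : Set X}

theorem MemEPlusOn.zero : MemEPlusOn κ B (0 : Measure X) := ⟨MemEPlus.zero, by simp⟩

theorem MemEPlusOn.add (hκ : IsAdmissibleKernel κ) (hμ : MemEPlusOn κ B μ)
    (hν : MemEPlusOn κ B ν) : MemEPlusOn κ B (μ + ν) :=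
  ⟨hμ.1.add hκ hν.1, by simp [hμ.2, hν.2]⟩

theorem MemEPlusOn.smul (hκ : IsAdmissibleKernel κ) (hμ : MemEPlusOn κ B μ) (c : ℝ≥0) :
    MemEPlusOn κ B (c • μ) :=
  ⟨hμ.1.smul hκ c, by simp [hμ.2]⟩

theorem MemEPlusOn.restrict (hκ : IsAdmissibleKernel κ) (hμ : MemEPlusOn κ B μ) (s : Set X) :
    MemEPlusOn κ B (μ.restrict s) :=
  ⟨hμ.1.restrict hκ s, Measure.absolutelyContinuous_of_le Measure.restrict_le_self hμ.2⟩

theorem MemEPlusOn.mono (hμ : MemEPlusOn κ A μ) (h : A ⊆ B) : MemEPlusOn κ B μ :=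
  ⟨hμ.1, measure_mono_null (Set.compl_subset_compl.2 h) hμ.2⟩

/-- The cone `𝓔⁺(B)` is closed under strong limits of sequences. -/
def IsStronglyClosed (κ : X → X → ℝ≥0∞) (B : Set X) : Prop :=
  ∀ (τ : ℕ → Measure X) (ν : Measure X), (∀ n, MemEPlusOn κ B (τ n)) → MemEPlus κ ν →
    StrongTendsto κ τ ν → ν Bᶜ = 0

theorem pairing_eq_lintegral (hκ : IsAdmissibleKernel κ) (hμ : MemEPlus κ μ)
    (hν : MemEPlus κ ν) : pairing κ μ ν = (∫⁻ x, potential κ μ x ∂ν).toReal := by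
  have := hμ.1
  rw [pairing_comm hκ hμ hν, pairing, mutualEnergy_eq_lintegral hκ]

theorem lintegral_potential_ne_top (hκ : IsAdmissibleKernel κ) (hμ : MemEPlus κ μ)
    (hν : MemEPlus κ ν) : ∫⁻ x, potential κ μ x ∂ν ≠ ∞ := by
  have := hμ.1
  rw [← mutualEnergy_eq_lintegral hκ]
  exact (mutualEnergy_lt_top hκ hν hμ).ne

/-- Almost everywhere inequality between an external field and a potential from the inequality
between the integrals. -/
theorem ae_le_potential (hκ : IsAdmissibleKernel κ) (hν : MemEPlus κ ν) {f : X → ℝ≥0∞}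
    (hf : Measurable f) (hτ : MemEPlusOn κ B τ)
    (h : ∀ σ, MemEPlusOn κ B σ → σ ≤ τ → ∫⁻ x, f x ∂σ ≠ ∞ ∧ (∫⁻ x, f x ∂σ).toReal ≤ pairing κ ν σ) :
    ∀ᵐ x ∂τ, f x ≤ potential κ ν x := by
  have := hτ.1.1
  refine ae_le_of_forall_setLIntegral_le_of_sigmaFinite hf fun s _ _ => ?_
  obtain ⟨h1, h2⟩ := h _ (hτ.restrict hκ s) Measure.restrict_le_self
  rw [pairing_eq_lintegral hκ hν (hτ.1.restrict hκ s)] at h2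
  exact (ENNReal.toReal_le_toReal h1
    (lintegral_potential_ne_top hκ hν (hτ.1.restrict hκ s))).1 h2

/-- The Gauss variational problem over `𝓔⁺(B)` with external field `f`. -/
theorem exists_gauss_minimizer (hκ : IsAdmissibleKernel κ) (hB : IsStronglyClosed κ B)
    {f : X → ℝ≥0∞} (hf : Measurable f) (hfin : ∀ τ, MemEPlusOn κ B τ → ∫⁻ x, f x ∂τ ≠ ∞)
    (hcont : ∀ (τ : ℕ → Measure X) (ν : Measure X), (∀ n, MemEPlusOn κ B (τ n)) →
      MemEPlusOn κ B ν → StrongTendsto κ τ ν →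
      Tendsto (fun n => (∫⁻ x, f x ∂(τ n)).toReal) atTop (𝓝 (∫⁻ x, f x ∂ν).toReal))
    (b : ℝ) (hb : ∀ τ, MemEPlusOn κ B τ → (∫⁻ x, f x ∂τ).toReal ≤ b * √(pairing κ τ τ)) :
    ∃ ν, MemEPlusOn κ B ν ∧
      (∀ τ, MemEPlusOn κ B τ → ∀ᵐ x ∂τ, f x ≤ potential κ ν x) ∧
      ∀ᵐ x ∂ν, potential κ ν x = f x := by
  set L : Measure X → ℝ := fun τ => (∫⁻ x, f x ∂τ).toReal with hLdef
  have hLadd : ∀ μ ν, MemEPlusOn κ B μ → MemEPlusOn κ B ν → L (μ + ν) = L μ + L ν :=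
    fun μ ν hμ hν => by
      simp only [hLdef, lintegral_add_measure]
      exact ENNReal.toReal_add (hfin μ hμ) (hfin ν hν)
  have hLsmul : ∀ (c : ℝ≥0) μ, L (c • μ) = c * L μ := fun c μ => by
    simp only [hLdef, lintegral_smul_measure, ENNReal.smul_def, smul_eq_mul, ENNReal.toReal_mul,
      ENNReal.coe_toReal]
  have hlow : ∀ μ ∈ {μ | MemEPlusOn κ B μ}, -b ^ 2 ≤ gaussFunctional κ L μ := fun μ hμ => by
    have h1 := hb μ hμ
    have h2 := Real.sq_sqrt (pairing_nonneg (κ := κ) μ μ)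
    simp only [gaussFunctional, hLdef]
    nlinarith [sq_nonneg (√(pairing κ μ μ) - b)]
  obtain ⟨τ, ν, hτ, hνE, hlim, hmin⟩ := exists_strongTendsto_of_antitone hκ
    (fun _ => {μ | MemEPlusOn κ B μ}) antitone_const (fun μ hμ => hμ.1)
    (fun _ μ hμ ν hν => (MemEPlusOn.add hκ hμ hν).smul hκ _) L
    (fun μ hμ ν hν => by rw [midpointMeasure, hLsmul, hLadd μ ν hμ hν]; push_cast; ring)
    (-b ^ 2) (gaussFunctional κ L 0) hlow (fun _ => ⟨0, MemEPlusOn.zero, le_rfl⟩)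
  have hν : MemEPlusOn κ B ν := ⟨hνE, hB τ ν hτ hνE hlim⟩
  have hJν : ∀ μ, MemEPlusOn κ B μ → gaussFunctional κ L ν ≤ gaussFunctional κ L μ := by
    intro μ hμ
    refine le_of_tendsto_of_tendsto
      ((hlim.pairing_self hκ (fun n => (hτ n).1) hνE).sub ((hcont τ ν hτ hν hlim).const_mul 2))
      ((tendsto_one_div_add_atTop_nhds_zero_nat (𝕜 := ℝ)).const_add (gaussFunctional κ L μ))
      (Eventually.of_forall fun n => hmin n μ hμ) |>.trans_eq (add_zero _)
  -- Variation in the direction `ν + sσ`, available since the class is a cone.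
  have hge : ∀ σ, MemEPlusOn κ B σ → L σ ≤ pairing κ ν σ := by
    intro σ hσ
    refine sub_nonneg.1 (nonneg_of_forall_quadratic (pairing_nonneg (κ := κ) σ σ) ?_)
    intro s _ _
    have hs := hσ.smul hκ s
    have h := hJν _ (hν.add hκ hs)
    rw [gaussFunctional, gaussFunctional, hLadd _ _ hν hs, hLsmul,
      pairing_add_left hκ hν.1 hs.1 (hν.add hκ hs).1, pairing_add_right hκ hν.1 hs.1 hν.1,
      pairing_add_right hκ hν.1 hs.1 hs.1, pairing_smul_left hκ s hν.1,
      pairing_smul_left hκ s hs.1, pairing_smul_right hκ s hσ.1 hν.1,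
      pairing_smul_right hκ s hσ.1 hσ.1, pairing_comm hκ hσ.1 hν.1] at h
    linarith
  -- Variation `(1 - s)ν`, which stays positive because `s ≤ 1`. With `f ≤ U^ν` holding `ν`-a.e.,
  -- this integral bound forces equality `ν`-a.e.
  have hle : pairing κ ν ν ≤ L ν := by
    refine sub_nonneg.1 (nonneg_of_forall_quadratic (pairing_nonneg (κ := κ) ν ν) ?_)
    intro s _ hs1
    have hs := hν.smul hκ (1 - s)
    have h := hJν _ hs
    rw [gaussFunctional, gaussFunctional, hLsmul, pairing_smul_left hκ _ hs.1,
      pairing_smul_right hκ _ hν.1 hν.1, NNReal.coe_sub hs1, NNReal.coe_one] at h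
    linarith
  have hae : ∀ τ, MemEPlusOn κ B τ → ∀ᵐ x ∂τ, f x ≤ potential κ ν x := fun τ hτ =>
    ae_le_potential hκ hν.1 hf hτ fun σ hσ _ => ⟨hfin σ hσ, hge σ hσ⟩
  refine ⟨ν, hν, hae, ?_⟩
  rw [pairing_eq_lintegral hκ hν.1 hν.1] at hle
  have h := ae_eq_of_ae_le_of_lintegral_le (hae ν hν) (hfin ν hν)
    (measurable_potential hκ ν).aemeasurable
    ((ENNReal.toReal_le_toReal (lintegral_potential_ne_top hκ hν.1 hν.1) (hfin ν hν)).1 hle)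
  exact h.mono fun x hx => hx.symm

end Concentrated

/-! ### Capacity estimates and quasiclosed sets. -/

section Capacity

variable {μ ν σ τ : Measure X} {A B E G K : Set X}

/-- The energy norm of a measure, with values in `[0, ∞]`. -/
noncomputable def energyNorm (κ : X → X → ℝ≥0∞) (μ : Measure X) : ℝ≥0∞ :=
  energy κ μ ^ (1 / 2 : ℝ)

theorem energyNorm_sq (μ : Measure X) : energyNorm κ μ ^ 2 = energy κ μ := by
  rw [energyNorm, ← ENNReal.rpow_natCast, ← ENNReal.rpow_mul]
  simp

theorem energyNorm_ne_top (hμ : MemEPlus κ μ) : energyNorm κ μ ≠ ∞ :=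
  ENNReal.rpow_ne_top_of_nonneg (by norm_num) hμ.2.ne

theorem energyNorm_eq_ofReal (hμ : MemEPlus κ μ) :
    energyNorm κ μ = ENNReal.ofReal √(pairing κ μ μ) := by
  rw [Real.sqrt_eq_rpow, ← ENNReal.ofReal_rpow_of_nonneg (pairing_nonneg _ _) (by norm_num),
    pairing, ENNReal.ofReal_toReal (show mutualEnergy κ μ μ ≠ ∞ from hμ.2.ne), energyNorm, energy]

theorem eq_zero_of_forall_le_mul {x R : ℝ≥0∞} (hR : R ≠ ∞) (h : ∀ δ : ℝ≥0∞, 0 < δ → x ≤ δ * R) :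
    x = 0 := by
  have hlim : Tendsto (fun δ : ℝ≥0∞ => δ * R) (𝓝[>] 0) (𝓝 (0 * R)) :=
    (ENNReal.Tendsto.mul_const tendsto_id (Or.inr hR)).mono_left nhdsWithin_le_nhds
  rw [zero_mul] at hlim
  exact le_antisymm (ge_of_tendsto hlim (eventually_mem_nhdsWithin.mono fun δ hδ => h δ hδ)) bot_le

theorem eq_zero_of_energy_eq_zero (hκ : IsAdmissibleKernel κ) (hμ : MemEPlus κ μ)
    (h : energy κ μ = 0) : μ = 0 := by
  refine (hκ.energyPrinciple μ 0 hμ.1 inferInstance).2 ?_ ?_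
  · rw [h]; simp [energy, mutualEnergy]
  · rw [h]; simp [energy, mutualEnergy]

theorem energy_smul (hκ : IsAdmissibleKernel κ) (c : ℝ≥0) (μ : Measure X)
    [IsLocallyFiniteMeasure μ] : energy κ (c • μ) = c ^ 2 * energy κ μ := by
  rw [energy, mutualEnergy_smul_left hκ, mutualEnergy_comm hκ, mutualEnergy_smul_left hκ, ← mul_assoc,
    sq, energy]

/-- The restriction of `μ` to `K`, normalized to mass one, competes in the infimum defining the
capacity. -/
theorem measure_sq_le_compactCap_mul (hκ : IsAdmissibleKernel κ) (hμ : MemEPlus κ μ)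
    (hK : MeasurableSet K) (hfin : μ K ≠ ∞) : μ K ^ 2 ≤ compactCap κ K * energy κ μ := by
  have := hμ.1
  rcases eq_or_ne (μ K) 0 with h0 | h0
  · simp [h0]
  have hI : energy κ μ ≠ 0 := fun h => h0 (by simp [eq_zero_of_energy_eq_zero hκ hμ h])
  obtain ⟨t, ht⟩ : ∃ t : ℝ≥0, (t : ℝ≥0∞) = μ K := ⟨_, ENNReal.coe_toNNReal hfin⟩
  have ht0 : t ≠ 0 := by rintro rfl; exact h0 (by simp [← ht])
  set w : ℝ≥0∞ := ⨅ (μ : Measure X) (_ : μ Set.univ = 1) (_ : μ Kᶜ = 0), energy κ μ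
  have hw : w ≤ (t⁻¹ : ℝ≥0) ^ 2 * energy κ μ := by
    have h1 : (t⁻¹ • μ.restrict K) Set.univ = 1 := by
      simp [ENNReal.smul_def, ← ht, ENNReal.coe_inv ht0, ENNReal.inv_mul_cancel
        (ENNReal.coe_ne_zero.2 ht0) ENNReal.coe_ne_top]
    have h2 : (t⁻¹ • μ.restrict K) Kᶜ = 0 := by
      simp [Measure.restrict_apply hK.compl]
    refine (iInf₂_le_of_le (t⁻¹ • μ.restrict K) h1 (iInf_le _ h2)).trans ?_
    rw [energy_smul hκ]
    gcongr
    exact mutualEnergy_mono hκ Measure.restrict_le_self Measure.restrict_le_self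
  have hw' : (t : ℝ≥0∞) ^ 2 * w ≤ energy κ μ := by
    calc (t : ℝ≥0∞) ^ 2 * w ≤ t ^ 2 * ((t⁻¹ : ℝ≥0) ^ 2 * energy κ μ) := by gcongr
      _ = energy κ μ := by
        rw [← mul_assoc, ← mul_pow, ← ENNReal.coe_mul, mul_inv_cancel₀ ht0]
        simp
  rw [← ht, compactCap, mul_comm, ← div_eq_mul_inv]
  exact (ENNReal.le_div_iff_mul_le (Or.inr hI) (Or.inr hμ.2.ne)).2 hw'

theorem measure_le_innerCap_mul (hκ : IsAdmissibleKernel κ) (hμ : MemEPlus κ μ)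
    (hE : NullMeasurableSet E μ) : μ E ≤ innerCap κ E ^ (1 / 2 : ℝ) * energyNorm κ μ := by
  have := hμ.1
  obtain ⟨E', hE'E, hE', hae⟩ := hE.exists_measurable_subset_ae_eq
  rw [← measure_congr hae]
  refine le_of_forall_lt fun r hr => ?_
  obtain ⟨K, hKE, hK, hrK⟩ := hE'.exists_lt_isCompact hr
  refine hrK.trans_le ?_
  have h := measure_sq_le_compactCap_mul hκ hμ hK.measurableSet hK.measure_lt_top.ne
  have h1 : compactCap κ K ≤ innerCap κ E :=
    le_iSup_of_le K (le_iSup_of_le hK (le_iSup_of_le (hKE.trans hE'E) le_rfl))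
  calc μ K = (μ K ^ 2) ^ (1 / 2 : ℝ) := by
        rw [← ENNReal.rpow_natCast, ← ENNReal.rpow_mul]; simp
    _ ≤ (innerCap κ E * energy κ μ) ^ (1 / 2 : ℝ) := by
        gcongr
        exact h.trans (by gcongr)
    _ = _ := by rw [ENNReal.mul_rpow_of_nonneg _ _ (by norm_num), energyNorm]

theorem measure_le_mul_of_innerCap_le (hκ : IsAdmissibleKernel κ) (hμ : MemEPlus κ μ)
    (hE : NullMeasurableSet E μ) {δ : ℝ≥0∞} (h : innerCap κ E ≤ δ ^ 2) :
    μ E ≤ δ * energyNorm κ μ := by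
  refine (measure_le_innerCap_mul hκ hμ hE).trans ?_
  gcongr
  calc innerCap κ E ^ (1 / 2 : ℝ) ≤ (δ ^ 2) ^ (1 / 2 : ℝ) := by gcongr
    _ = δ := by rw [← ENNReal.rpow_natCast, ← ENNReal.rpow_mul]; simp

theorem exists_measure_of_lt_innerCap {δ : ℝ≥0∞} (h : δ < innerCap κ E) :
    ∃ (μ : Measure X) (K : Set X), IsCompact K ∧ K ⊆ E ∧ μ Set.univ = 1 ∧ μ Kᶜ = 0 ∧
      MemEPlus κ μ ∧ energy κ μ < δ⁻¹ := by
  simp only [innerCap, lt_iSup_iff] at h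
  obtain ⟨K, hK, hKE, hδ⟩ := h
  have h' := ENNReal.inv_lt_inv.2 hδ
  rw [compactCap, inv_inv] at h'
  simp only [iInf_lt_iff] at h'
  obtain ⟨μ, h1, h2, h3⟩ := h'
  have : IsFiniteMeasure μ := ⟨by simp [h1]⟩
  exact ⟨μ, K, hK, hKE, h1, h2, ⟨inferInstance, h3.trans_le le_top⟩, h3⟩

/-- Converse of the preceding mass estimates: a larger capacity would give a probability measure on
a compact subset of `E` with energy below `δ⁻²`. Together they replace capacity by a bound on
masses, which is visibly countably subadditive. -/
theorem innerCap_le_sq (δ : ℝ≥0∞)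
    (h : ∀ μ, MemEPlus κ μ → μ Set.univ = 1 → μ E ≤ δ * energyNorm κ μ) :
    innerCap κ E ≤ δ ^ 2 := by
  by_contra! hlt
  obtain ⟨μ, K, hK, hKE, h1, h2, hμ, hlt'⟩ := exists_measure_of_lt_innerCap hlt
  have hE : 1 ≤ μ E := by
    rw [← h1]
    calc μ Set.univ ≤ μ K + μ Kᶜ := by
          rw [← Set.union_compl_self K]; exact measure_union_le _ _
      _ ≤ μ E := by rw [h2, add_zero]; exact measure_mono hKE
  have h3 : 1 ≤ (δ * energyNorm κ μ) ^ 2 := one_le_pow₀ (hE.trans (h μ hμ h1))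
  rw [mul_pow, energyNorm_sq, mul_comm] at h3
  refine absurd hlt' (not_lt.2 ?_)
  rw [← one_div]
  exact ENNReal.div_le_of_le_mul h3

/-- A set of positive inner capacity carries a nonzero measure of finite energy on a compact subset.
Testing on compact subsets only is what the bounded-field case provides. -/
theorem nearlyEverywhereOn_of_ae {P : X → Prop}
    (h : ∀ τ K, IsCompact K → K ⊆ A → MemEPlusOn κ K τ → ∀ᵐ x ∂τ, P x) :
    NearlyEverywhereOn κ A P := by
  by_contra hne
  obtain ⟨μ, K, hK, hKE, h1, h2, hμ, -⟩ := exists_measure_of_lt_innerCap (pos_iff_ne_zero.2 hne)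
  have hP := h μ K hK (hKE.trans (Set.sep_subset _ _)) ⟨hμ, h2⟩
  have h0 : μ Set.univ = 0 := by
    refine measure_mono_null (t := Kᶜ ∪ {x | ¬ P x}) (fun x _ => ?_)
      (measure_union_null h2 (ae_iff.1 hP))
    by_cases hx : x ∈ K
    · exact Or.inr (hKE hx).2
    · exact Or.inl hx
  simp [h0] at h1

theorem NearlyEverywhereOn.ae (hκ : IsAdmissibleKernel κ) {P : X → Prop}
    (hP : MeasurableSet {x | P x}) (hA : NullMeasurableSet A τ)
    (h : NearlyEverywhereOn κ A P) (hτ : MemEPlusOn κ A τ) : ∀ᵐ x ∂τ, P x := by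
  have h0 := measure_le_innerCap_mul hκ hτ.1 (E := {x ∈ A | ¬ P x})
    (hA.inter hP.compl.nullMeasurableSet)
  rw [NearlyEverywhereOn] at h
  rw [h] at h0
  have h1 : τ {x ∈ A | ¬ P x} = 0 := by
    refine le_antisymm (h0.trans_eq ?_) bot_le
    simp
  refine ae_iff.2 (measure_mono_null (t := Aᶜ ∪ {x ∈ A | ¬ P x}) (fun x hx => ?_)
    (measure_union_null hτ.2 h1))
  by_cases hx' : x ∈ A
  · exact Or.inr ⟨hx', hx⟩
  · exact Or.inl hx'

theorem outerCap_eq_zero_of_forall (h : ∀ δ : ℝ≥0∞, 0 < δ → ∃ G, IsOpen G ∧ E ⊆ G ∧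
    ∀ μ, MemEPlus κ μ → μ G ≤ δ * energyNorm κ μ) : outerCap κ E = 0 := by
  have hle : ∀ δ : ℝ≥0∞, 0 < δ → outerCap κ E ≤ δ ^ 2 := fun δ hδ => by
    obtain ⟨G, hG, hEG, hμ⟩ := h δ hδ
    exact (iInf₂_le_of_le G hG (iInf_le _ hEG)).trans
      (innerCap_le_sq δ fun μ hμ' _ => hμ μ hμ')
  have hlim : Tendsto (fun δ : ℝ≥0∞ => δ ^ 2) (𝓝[>] 0) (𝓝 (0 ^ 2)) :=
    ((ENNReal.continuous_pow 2).tendsto 0).mono_left nhdsWithin_le_nhds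
  rw [zero_pow two_ne_zero] at hlim
  exact le_antisymm (ge_of_tendsto hlim (eventually_mem_nhdsWithin.mono hle)) bot_le

theorem exists_isOpen_of_outerCap_lt (hκ : IsAdmissibleKernel κ) {δ : ℝ≥0∞}
    (h : outerCap κ E < δ ^ 2) : ∃ G, IsOpen G ∧ E ⊆ G ∧
    ∀ μ, MemEPlus κ μ → μ G ≤ δ * energyNorm κ μ := by
  simp only [outerCap, iInf_lt_iff] at h
  obtain ⟨G, hG, hEG, h⟩ := h
  exact ⟨G, hG, hEG, fun μ hμ =>
    measure_le_mul_of_innerCap_le hκ hμ hG.measurableSet.nullMeasurableSet h.le⟩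

/-- Open covers with mass constants `δ' n` are united; the constants add up to less than `δ`. -/
theorem outerCap_iUnion_eq_zero (hκ : IsAdmissibleKernel κ) {E : ℕ → Set X}
    (h : ∀ n, outerCap κ (E n) = 0) : outerCap κ (⋃ n, E n) = 0 := by
  refine outerCap_eq_zero_of_forall fun δ hδ => ?_
  obtain ⟨δ', hδ'pos, hδ'⟩ := ENNReal.exists_pos_sum_of_countable' hδ.ne' ℕ
  have hex : ∀ n, ∃ G, IsOpen G ∧ E n ⊆ G ∧ ∀ μ, MemEPlus κ μ → μ G ≤ δ' n * energyNorm κ μ :=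
    fun n => exists_isOpen_of_outerCap_lt hκ (by rw [h n]; exact ENNReal.pow_pos (hδ'pos n) 2)
  choose G hG hEG hμG using hex
  refine ⟨⋃ n, G n, isOpen_iUnion hG, Set.iUnion_mono hEG, fun μ hμ => ?_⟩
  calc μ (⋃ n, G n) ≤ ∑' n, μ (G n) := measure_iUnion_le _
    _ ≤ ∑' n, δ' n * energyNorm κ μ := ENNReal.tsum_le_tsum fun n => hμG n μ hμ
    _ ≤ δ * energyNorm κ μ := by rw [ENNReal.tsum_mul_right]; gcongr

theorem IsQuasiclosed.exists_isClosed_isOpen (hκ : IsAdmissibleKernel κ) (hA : IsQuasiclosed κ A)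
    {δ : ℝ≥0∞} (hδ : 0 < δ) : ∃ F G, IsClosed F ∧ IsOpen G ∧ symmDiff A F ⊆ G ∧
      ∀ μ, MemEPlus κ μ → μ G ≤ δ * energyNorm κ μ := by
  have h : ⨅ (F : Set X) (_ : IsClosed F), outerCap κ (symmDiff A F) < δ ^ 2 := by
    rw [IsQuasiclosed] at hA
    rw [hA]
    exact ENNReal.pow_pos hδ 2
  simp only [iInf_lt_iff] at h
  obtain ⟨F, hF, h⟩ := h
  obtain ⟨G, hG, hsub, hμ⟩ := exists_isOpen_of_outerCap_lt hκ h
  exact ⟨F, G, hF, hG, hsub, hμ⟩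

/-- The Borel sets `F n \ G n` lie in `A`, and what their union misses lies in every `G n`, whose
mass is at most `‖μ‖/(n + 1)`. -/
theorem IsQuasiclosed.nullMeasurableSet (hκ : IsAdmissibleKernel κ) (hA : IsQuasiclosed κ A)
    (hμ : MemEPlus κ μ) : NullMeasurableSet A μ := by
  have hex : ∀ n : ℕ, ∃ F G, IsClosed F ∧ IsOpen G ∧ symmDiff A F ⊆ G ∧
      ∀ μ, MemEPlus κ μ → μ G ≤ ((n : ℝ≥0∞) + 1)⁻¹ * energyNorm κ μ := fun n =>
    hA.exists_isClosed_isOpen hκ (ENNReal.inv_pos.2 (by finiteness))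
  choose F G hF hG hsub hμG using hex
  have hS : MeasurableSet (⋃ n, F n \ G n) :=
    MeasurableSet.iUnion fun n => (hF n).measurableSet.diff (hG n).measurableSet
  have hSA : ⋃ n, F n \ G n ⊆ A := by
    refine Set.iUnion_subset fun n x hx => ?_
    by_contra hxA
    exact hx.2 (hsub n (Or.inr ⟨hx.1, hxA⟩))
  have hdiff : μ (A \ ⋃ n, F n \ G n) = 0 := by
    have hsubG : ∀ n, A \ ⋃ n, F n \ G n ⊆ G n := fun n x hx => by
      by_contra hxG
      refine hx.2 (Set.mem_iUnion.2 ⟨n, ?_, hxG⟩)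
      by_contra hxF
      exact hxG (hsub n (Or.inl ⟨hx.1, hxF⟩))
    have hlim : Tendsto (fun n : ℕ => ((n : ℝ≥0∞) + 1)⁻¹ * energyNorm κ μ) atTop
        (𝓝 (0 * energyNorm κ μ)) := by
      refine ENNReal.Tendsto.mul_const ?_ (Or.inr (energyNorm_ne_top hμ))
      have := (tendsto_add_atTop_iff_nat 1).2 ENNReal.tendsto_inv_nat_nhds_zero
      simpa using this
    rw [zero_mul] at hlim
    exact le_antisymm (ge_of_tendsto' hlim fun n =>
      (measure_mono (hsubG n)).trans (hμG n μ hμ)) bot_le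
  have : A = (⋃ n, F n \ G n) ∪ (A \ ⋃ n, F n \ G n) := (Set.union_sdiff_cancel hSA).symm
  rw [this]
  exact hS.nullMeasurableSet.union (NullMeasurableSet.of_null hdiff)

theorem VagueTendsto.lintegral {τ : ℕ → Measure X} (hτ : ∀ n, IsLocallyFiniteMeasure (τ n))
    [IsLocallyFiniteMeasure ν] (h : VagueTendsto τ ν) {φ : X → ℝ} (hφ : Continuous φ)
    (hφc : HasCompactSupport φ) (hφ0 : ∀ x, 0 ≤ φ x) :
    Tendsto (fun n => ∫⁻ x, ENNReal.ofReal (φ x) ∂(τ n)) atTop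
      (𝓝 (∫⁻ x, ENNReal.ofReal (φ x) ∂ν)) := by
  have e : ∀ μ : Measure X, IsLocallyFiniteMeasure μ →
      ENNReal.ofReal (∫ x, φ x ∂μ) = ∫⁻ x, ENNReal.ofReal (φ x) ∂μ := fun μ _ =>
    ofReal_integral_eq_lintegral_ofReal (hφ.integrable_of_hasCompactSupport hφc)
      (Eventually.of_forall hφ0)
  rw [← e ν inferInstance]
  simp only [← e _ (hτ _)]
  exact (ENNReal.continuous_ofReal.tendsto _).comp (h φ hφ hφc)

theorem StrongTendsto.exists_energyNorm_le (hκ : IsAdmissibleKernel κ) {τ : ℕ → Measure X}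
    (hτ : ∀ n, MemEPlus κ (τ n)) (hν : MemEPlus κ ν) (h : StrongTendsto κ τ ν) :
    ∃ R : ℝ≥0∞, R ≠ ∞ ∧ (∀ n, energyNorm κ (τ n) ≤ R) ∧ energyNorm κ ν ≤ R := by
  have hlim := h.pairing_self hκ hτ hν
  obtain ⟨b, hb⟩ := hlim.bddAbove_range
  have hb' : ∀ n, pairing κ (τ n) (τ n) ≤ b := fun n => hb ⟨n, rfl⟩
  refine ⟨ENNReal.ofReal √b, ENNReal.ofReal_ne_top, fun n => ?_, ?_⟩
  · rw [energyNorm_eq_ofReal (hτ n)]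
    gcongr
    exact hb' n
  · rw [energyNorm_eq_ofReal hν]
    gcongr
    exact le_of_tendsto' hlim hb'

/-- Replacing `A` by a closed `F` costs mass at most `δ * R`, with `R` a common bound for the norms.
The mass of the open set `Fᶜ` does not increase under vague limits beyond this bound, so one can
return to `A` and let `δ` tend to zero. -/
theorem IsQuasiclosed.isStronglyClosed (hκ : IsAdmissibleKernel κ) (hA : IsQuasiclosed κ A) :
    IsStronglyClosed κ A := by
  intro τ ν hτ hν h
  have := hν.1
  obtain ⟨R, hR, hτR, hνR⟩ := h.exists_energyNorm_le hκ (fun n => (hτ n).1) hν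
  have hvague := hκ.consistency.2 τ ν (fun n => (hτ n).1) hν h
  refine eq_zero_of_forall_le_mul (R := R + R) (by finiteness) fun δ hδ => ?_
  obtain ⟨F, G, hF, hG, hsub, hμG⟩ := hA.exists_isClosed_isOpen hκ hδ
  have hτF : ∀ n, τ n Fᶜ ≤ δ * R := fun n =>
    calc τ n Fᶜ ≤ τ n (Aᶜ ∪ G) := measure_mono fun x hx => by
          by_cases hxA : x ∈ A
          · exact Or.inr (hsub (Or.inl ⟨hxA, hx⟩))
          · exact Or.inl hxA
      _ ≤ τ n Aᶜ + τ n G := measure_union_le _ _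
      _ ≤ δ * R := by
        rw [(hτ n).2, zero_add]
        exact (hμG _ (hτ n).1).trans (by gcongr; exact hτR n)
  have hνF : ν Fᶜ ≤ δ * R := by
    refine le_of_forall_lt fun r hr => ?_
    obtain ⟨K, hKF, hK, hrK⟩ := hF.isOpen_compl.measurableSet.exists_lt_isCompact hr
    refine hrK.trans_le ?_
    obtain ⟨φ, hφ1, hφ0, hφc, hφI⟩ := exists_continuous_one_zero_of_isCompact hK hF
      (Set.disjoint_left.2 fun x hx hxF => hKF hx hxF)
    have hlim := hvague.lintegral (fun n => (hτ n).1.1) φ.continuous hφc fun x => (hφI x).1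
    calc ν K = ∫⁻ x, K.indicator 1 x ∂ν := (lintegral_indicator_one hK.measurableSet).symm
      _ ≤ ∫⁻ x, ENNReal.ofReal (φ x) ∂ν := by
        refine lintegral_mono fun x => ?_
        by_cases hx : x ∈ K
        · simp [hx, hφ1 hx]
        · simp [hx]
      _ ≤ δ * R := by
        refine le_of_tendsto' hlim fun n => ?_
        calc ∫⁻ x, ENNReal.ofReal (φ x) ∂(τ n) ≤ ∫⁻ x, Fᶜ.indicator 1 x ∂(τ n) := by
              refine lintegral_mono fun x => ?_
              by_cases hx : x ∈ F
              · simp [hφ0 hx]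
              · simp [hx, (hφI x).2]
          _ = τ n Fᶜ := lintegral_indicator_one hF.isOpen_compl.measurableSet
          _ ≤ δ * R := hτF n
  calc ν Aᶜ ≤ ν (Fᶜ ∪ G) := measure_mono fun x hx => by
        by_cases hxF : x ∈ F
        · exact Or.inr (hsub (Or.inr ⟨hxF, hx⟩))
        · exact Or.inl hxF
    _ ≤ ν Fᶜ + ν G := measure_union_le _ _
    _ ≤ δ * R + δ * R := add_le_add hνF ((hμG ν hν).trans (by gcongr))
    _ = δ * (R + R) := (mul_add _ _ _).symm

theorem outerCap_empty : outerCap κ (∅ : Set X) = 0 :=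
  outerCap_eq_zero_of_forall fun _ _ => ⟨∅, isOpen_empty, le_rfl, fun μ _ => by simp⟩

theorem isQuasiclosed_of_isClosed (hA : IsClosed A) : IsQuasiclosed κ A := by
  refine le_antisymm ((iInf_le_of_le A (iInf_le _ hA)).trans_eq ?_) bot_le
  rw [symmDiff_self]
  exact outerCap_empty

theorem IsStronglyClosed.iInter {A : ℕ → Set X} (hA : ∀ j, IsStronglyClosed κ (A j)) :
    IsStronglyClosed κ (⋂ j, A j) := by
  intro τ ν hτ hν h
  rw [Set.compl_iInter]
  exact measure_iUnion_null fun j =>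
    hA j τ ν (fun n => (hτ n).mono (Set.iInter_subset _ j)) hν h

end Capacity

/-! ### Equilibrium and balayage on compact sets. -/

section CompactSets

variable {μ ν σ τ ω : Measure X} {A B E G K : Set X}

theorem MemEPlusOn.measure_univ_lt_top (hK : IsCompact K) (hν : MemEPlusOn κ K ν) :
    ν Set.univ < ∞ := by
  have := hν.1.1
  calc ν Set.univ ≤ ν K + ν Kᶜ := by
        rw [← Set.union_compl_self K]; exact measure_union_le _ _
    _ < ∞ := by rw [hν.2, add_zero]; exact hK.measure_lt_top

theorem MemEPlusOn.ae_mem (hν : MemEPlusOn κ K ν) : ∀ᵐ x ∂ν, x ∈ K := hν.2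

/-- The total mass of a measure on a compact set is controlled by its energy norm. -/
theorem exists_mass_le (hκ : IsAdmissibleKernel κ) (hK : IsCompact K) :
    ∃ b : ℝ, 0 ≤ b ∧ ∀ ν, MemEPlusOn κ K ν → (ν Set.univ).toReal ≤ b * √(pairing κ ν ν) := by
  by_contra! hcon
  -- Normalized to mass one, these measures tend strongly, hence vaguely, to zero; a cutoff function
  -- equal to 1 on `K` contradicts this.
  choose ν hν hlt using fun n : ℕ => hcon ((n : ℝ) + 1) (by positivity)
  set m : ℕ → ℝ≥0 := fun n => (ν n Set.univ).toNNReal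
  have hm : ∀ n, (m n : ℝ≥0∞) = ν n Set.univ := fun n =>
    ENNReal.coe_toNNReal ((hν n).measure_univ_lt_top hK).ne
  have hmlt : ∀ n : ℕ, ((n : ℝ) + 1) * √(pairing κ (ν n) (ν n)) < m n := fun n => hlt n
  have hmpos : ∀ n, 0 < m n := fun n =>
    NNReal.coe_pos.1 (lt_of_le_of_lt (by positivity) (hmlt n))
  set σ : ℕ → Measure X := fun n => (m n)⁻¹ • ν n
  have hσ : ∀ n, MemEPlusOn κ K (σ n) := fun n => (hν n).smul hκ _
  have hσ1 : ∀ n, σ n Set.univ = 1 := fun n => by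
    simp only [σ, Measure.smul_apply, ← hm, ENNReal.smul_def, smul_eq_mul, ← ENNReal.coe_mul]
    rw [inv_mul_cancel₀ (hmpos n).ne']
    rfl
  have hpair0 : ∀ ρ : Measure X, pairing κ ρ 0 = 0 := fun ρ => by simp [pairing, mutualEnergy]
  have hdist : ∀ n : ℕ, strongDist κ (σ n) 0 ≤ 1 / ((n : ℝ) + 1) := by
    intro n
    refine (sq_le_sq₀ strongDist_nonneg (by positivity)).1 ?_
    rw [strongDist_sq hκ (hσ n).1 MemEPlus.zero, hpair0, hpair0,
      pairing_smul_left hκ _ (hσ n).1, pairing_smul_right hκ _ (hν n).1 (hν n).1]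
    have h1 := Real.sq_sqrt (pairing_nonneg (κ := κ) (ν n) (ν n))
    have h2 := pow_le_pow_left₀ (by positivity) (hmlt n).le 2
    have h3 : (0 : ℝ) < m n := NNReal.coe_pos.2 (hmpos n)
    rw [mul_pow, h1] at h2
    rw [NNReal.coe_inv, div_pow, one_pow, le_div_iff₀ (by positivity)]
    have h4 : ((m n : ℝ)⁻¹ * ((m n : ℝ)⁻¹ * pairing κ (ν n) (ν n)) + 0 - 2 * 0) * ((n : ℝ) + 1) ^ 2
      = (((n : ℝ) + 1) ^ 2 * pairing κ (ν n) (ν n)) / (m n : ℝ) ^ 2 := by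
      field_simp
      ring
    rw [h4]
    exact (div_le_one (by positivity)).2 h2
  have hstrong : StrongTendsto κ σ 0 :=
    squeeze_zero (fun n => strongDist_nonneg) hdist tendsto_one_div_add_atTop_nhds_zero_nat
  have hvague := hκ.consistency.2 σ 0 (fun n => (hσ n).1) MemEPlus.zero hstrong
  obtain ⟨φ, hφ1, -, hφc, hφI⟩ := exists_continuous_one_zero_of_isCompact hK isClosed_empty
    (Set.disjoint_empty K)
  have hlim := hvague.lintegral (fun n => (hσ n).1.1) φ.continuous hφc fun x => (hφI x).1
  rw [lintegral_zero_measure] at hlim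
  have h1 : ∀ n, 1 ≤ ∫⁻ x, ENNReal.ofReal (φ x) ∂(σ n) := fun n => by
    calc (1 : ℝ≥0∞) = ∫⁻ _, 1 ∂(σ n) := by rw [lintegral_one, hσ1]
      _ ≤ _ := lintegral_mono_ae ((hσ n).ae_mem.mono fun x hx => by simp [hφ1 hx])
  exact absurd (ge_of_tendsto' hlim h1) (by simp)

/-- Tietze extension times a cutoff. It turns the external field on `K` into a test function, so
that vague convergence applies to it. -/
theorem exists_continuous_extension (hK : IsCompact K) {f : X → ℝ≥0∞} (hf : ContinuousOn f K)
    (hfin : ∀ x ∈ K, f x ≠ ∞) : ∃ φ : X → ℝ, Continuous φ ∧ HasCompactSupport φ ∧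
      (∀ x, 0 ≤ φ x) ∧ ∀ x ∈ K, f x = ENNReal.ofReal (φ x) := by
  have hcont : Continuous fun x : K => (f x).toNNReal :=
    ENNReal.continuousOn_toNNReal.comp_continuous (continuousOn_iff_continuous_domRestrict.1 hf)
      fun x => hfin x x.2
  obtain ⟨g, hg⟩ := ContinuousMap.exists_restrict_eq hK.isClosed (⟨_, hcont⟩ : C(K, ℝ≥0))
  obtain ⟨φ, hφ1, -, hφc, hφI⟩ := exists_continuous_one_zero_of_isCompact hK isClosed_empty
    (Set.disjoint_empty K)
  refine ⟨fun x => φ x * g x, by fun_prop, hφc.mul_right, fun x =>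
    mul_nonneg (hφI x).1 (g x).2, fun x hx => ?_⟩
  have h : g x = (f x).toNNReal := congrArg (fun h : C(K, ℝ≥0) => h ⟨x, hx⟩) hg
  beta_reduce
  rw [hφ1 hx, h, Pi.one_apply, one_mul, ENNReal.ofReal_coe_nnreal, ENNReal.coe_toNNReal (hfin x hx)]

/-- The Gauss variational problem on a compact set with continuous external field. -/
theorem exists_gauss_minimizer_of_isCompact (hκ : IsAdmissibleKernel κ) (hK : IsCompact K)
    {f : X → ℝ≥0∞} (hf : Measurable f) (hfc : ContinuousOn f K) {C : ℝ≥0}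
    (hC : ∀ x ∈ K, f x ≤ C) :
    ∃ ν, MemEPlusOn κ K ν ∧
      (∀ τ, MemEPlusOn κ K τ → ∀ᵐ x ∂τ, f x ≤ potential κ ν x) ∧
      ∀ᵐ x ∂ν, potential κ ν x = f x := by
  obtain ⟨b, hb0, hb⟩ := exists_mass_le hκ hK
  obtain ⟨φ, hφ, hφc, hφ0, hφf⟩ := exists_continuous_extension hK hfc
    fun x hx => ((hC x hx).trans_lt ENNReal.coe_lt_top).ne
  have hle : ∀ τ, MemEPlusOn κ K τ → ∫⁻ x, f x ∂τ ≤ C * τ Set.univ := fun τ hτ => by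
    rw [← lintegral_const]
    exact lintegral_mono_ae (hτ.ae_mem.mono hC)
  have hfin : ∀ τ, MemEPlusOn κ K τ → ∫⁻ x, f x ∂τ ≠ ∞ := fun τ hτ =>
    ((hle τ hτ).trans_lt (ENNReal.mul_lt_top ENNReal.coe_lt_top
      (hτ.measure_univ_lt_top hK))).ne
  have hint : ∀ τ, MemEPlusOn κ K τ → ∫⁻ x, f x ∂τ = ∫⁻ x, ENNReal.ofReal (φ x) ∂τ :=
    fun τ hτ => lintegral_congr_ae (hτ.ae_mem.mono hφf)
  refine exists_gauss_minimizer hκ ((isQuasiclosed_of_isClosed hK.isClosed).isStronglyClosed hκ) hf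
    hfin (fun τ ν hτ hν h => ?_) (C * b) fun τ hτ => ?_
  · have := hν.1.1
    have hlim := (hκ.consistency.2 τ ν (fun n => (hτ n).1) hν.1 h).lintegral
      (fun n => (hτ n).1.1) hφ hφc hφ0
    rw [← hint ν hν] at hlim
    simp only [← hint _ (hτ _)] at hlim
    exact (ENNReal.tendsto_toReal (hfin ν hν)).comp hlim
  · calc (∫⁻ x, f x ∂τ).toReal ≤ (C * τ Set.univ).toReal :=
          ENNReal.toReal_mono (ENNReal.mul_ne_top ENNReal.coe_ne_top
            (hτ.measure_univ_lt_top hK).ne) (hle τ hτ)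
      _ = C * (τ Set.univ).toReal := by rw [ENNReal.toReal_mul, ENNReal.coe_toReal]
      _ ≤ C * (b * √(pairing κ τ τ)) := by gcongr; exact hb τ hτ
      _ = C * b * √(pairing κ τ τ) := by ring

/-- Existence of the equilibrium measure of a compact set. -/
theorem exists_equilibrium (hκ : IsAdmissibleKernel κ) (hK : IsCompact K) :
    ∃ γ, MemEPlusOn κ K γ ∧ (∀ τ, MemEPlusOn κ K τ → ∀ᵐ x ∂τ, 1 ≤ potential κ γ x) ∧
      ∀ᵐ x ∂γ, potential κ γ x = 1 :=
  exists_gauss_minimizer_of_isCompact hκ hK measurable_const continuousOn_const (C := 1)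
    fun _ _ => by simp

/-- Domination supplies the upper bound that the Gauss problem leaves open off the support of its
minimizer. -/
theorem potential_le_of_ae_eq (hκ : IsAdmissibleKernel κ) [IsLocallyFiniteMeasure ω]
    (hν : MemEPlus κ ν) (h : ∀ᵐ x ∂ν, potential κ ν x = potential κ ω x) (x : X) :
    potential κ ν x ≤ potential κ ω x :=
  hκ.domination ν ω hν inferInstance (h.mono fun _ hx => hx.le) x

/-- Balayage of a measure of finite energy onto a set `B` for which `𝓔⁺(B)` is strongly closed. -/
theorem exists_balayage (hκ : IsAdmissibleKernel κ) (hB : IsStronglyClosed κ B)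
    (hω : MemEPlus κ ω) : ∃ ν, MemEPlusOn κ B ν ∧
      ∀ τ, MemEPlusOn κ B τ → ∀ᵐ x ∂τ, potential κ ν x = potential κ ω x := by
  have := hω.1
  obtain ⟨ν, hν, hge, heq⟩ := exists_gauss_minimizer hκ hB (measurable_potential hκ ω)
    (fun τ hτ => lintegral_potential_ne_top hκ hω hτ.1)
    (fun τ ν hτ hν h => by
      simp only [← pairing_eq_lintegral hκ hω (hτ _).1, ← pairing_eq_lintegral hκ hω hν.1]
      exact h.pairing_left hκ (fun n => (hτ n).1) hν.1 hω)
    √(pairing κ ω ω) fun τ hτ => by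
      rw [← pairing_eq_lintegral hκ hω hτ.1, ← Real.sqrt_mul (pairing_nonneg _ _)]
      exact Real.le_sqrt_of_sq_le (pairing_sq_le hκ hω hτ.1)
  exact ⟨ν, hν, fun τ hτ => (hge τ hτ).mono fun x hx =>
    le_antisymm (potential_le_of_ae_eq hκ hν.1 heq x) hx⟩

/-- Balayage onto a compact set on which the potential is bounded and continuous. -/
theorem exists_balayage_of_isCompact (hκ : IsAdmissibleKernel κ) (hK : IsCompact K)
    [IsLocallyFiniteMeasure ω] (husc : UpperSemicontinuousOn (potential κ ω) K) {C : ℝ≥0}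
    (hC : ∀ x ∈ K, potential κ ω x ≤ C) : ∃ ν, MemEPlusOn κ K ν ∧
      (∀ τ, MemEPlusOn κ K τ → ∀ᵐ x ∂τ, potential κ ν x = potential κ ω x) ∧
      ∀ x, potential κ ν x ≤ potential κ ω x := by
  obtain ⟨ν, hν, hge, heq⟩ := exists_gauss_minimizer_of_isCompact hκ hK
    (measurable_potential hκ ω) (continuousOn_iff_lower_upperSemicontinuousOn.2
      ⟨(lowerSemicontinuous_potential hκ ω).lowerSemicontinuousOn K, husc⟩) hC
  exact ⟨ν, hν, fun τ hτ => (hge τ hτ).mono fun x hx =>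
    le_antisymm (potential_le_of_ae_eq hκ hν.1 heq x) hx, potential_le_of_ae_eq hκ hν.1 heq⟩

end CompactSets

/-! ### Replacing a bounded field by a measure of finite energy. -/

section BoundedField

variable {μ ν σ τ ω : Measure X} {A B E G K : Set X}

theorem lintegral_ne_top_of_isCompact (hK : IsCompact K) {f : X → ℝ≥0∞} {C : ℝ≥0}
    (hC : ∀ x ∈ K, f x ≤ C) (hτ : MemEPlusOn κ K τ) : ∫⁻ x, f x ∂τ ≠ ∞ := by
  refine ne_top_of_le_ne_top (ENNReal.mul_ne_top (ENNReal.coe_ne_top (r := C))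
    (hτ.measure_univ_lt_top hK).ne) ?_
  rw [← lintegral_const]
  exact lintegral_mono_ae (hτ.ae_mem.mono hC)

/-- The energies of measures on compact sets with potentials below that of a bounded measure. -/
theorem energy_le_of_potential_le (hκ : IsAdmissibleKernel κ) {M : ℝ≥0}
    (hM : ∀ (μ : Measure X) (c : ℝ≥0), MemEPlus κ μ → 0 < c →
      (∀ᵐ x ∂μ, potential κ μ x ≤ c) → ∀ x, potential κ μ x ≤ M * c)
    (hK : IsCompact K) [IsLocallyFiniteMeasure ω] {C : ℝ≥0}
    (hC : ∀ x ∈ K, potential κ ω x ≤ C) (hν : MemEPlusOn κ K ν)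
    (hle : ∀ x, potential κ ν x ≤ potential κ ω x) :
    energy κ ν ≤ C * (M * ω Set.univ) := by
  have := hν.1.1
  obtain ⟨γ, hγ, hγ1, hγeq⟩ := exists_equilibrium hκ hK
  have := hγ.1.1
  have hγM : ∀ x, potential κ γ x ≤ M := fun x => by
    have h := hM γ 1 hγ.1 one_pos (hγeq.mono fun x hx => by simp [hx]) x
    simpa using h
  -- The mass is tested against the equilibrium potential, which is at least 1 `ν`-a.e. and at most
  -- `M` everywhere; symmetry of the kernel moves the comparison to `γ`.
  have hmass : ν Set.univ ≤ M * ω Set.univ :=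
    calc ν Set.univ = ∫⁻ _, 1 ∂ν := (lintegral_one).symm
      _ ≤ ∫⁻ x, potential κ γ x ∂ν := lintegral_mono_ae (hγ1 ν hν)
      _ = ∫⁻ x, potential κ ν x ∂γ := by
        rw [← mutualEnergy_eq_lintegral hκ, mutualEnergy_comm hκ, mutualEnergy_eq_lintegral hκ]
      _ ≤ ∫⁻ x, potential κ ω x ∂γ := lintegral_mono hle
      _ = ∫⁻ x, potential κ γ x ∂ω := by
        rw [← mutualEnergy_eq_lintegral hκ, mutualEnergy_comm hκ, mutualEnergy_eq_lintegral hκ]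
      _ ≤ ∫⁻ _, M ∂ω := lintegral_mono hγM
      _ = M * ω Set.univ := lintegral_const _
  calc energy κ ν = ∫⁻ x, potential κ ν x ∂ν := mutualEnergy_eq_lintegral hκ ν ν
    _ ≤ ∫⁻ _, C ∂ν := lintegral_mono_ae (hν.ae_mem.mono fun x hx => (hle x).trans (hC x hx))
    _ = C * ν Set.univ := lintegral_const _
    _ ≤ C * (M * ω Set.univ) := by gcongr

/-- Under the assumptions on a bounded field, the potential `U^ω` coincides on `A` with the
potential of a measure of finite energy. -/
theorem BoundedFieldOn.exists_memEPlus (hκ : IsAdmissibleKernel κ) [IsLocallyFiniteMeasure ω]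
    (hω : BoundedFieldOn κ ω A) : ∃ ω', MemEPlus κ ω' ∧
      ∀ τ K, IsCompact K → K ⊆ A → MemEPlusOn κ K τ →
        ∀ᵐ x ∂τ, potential κ ω' x = potential κ ω x := by
  obtain ⟨M, -, hM⟩ := hκ.ugaheri
  obtain ⟨C, hC⟩ := hω.bounded_potential
  set L : Measure X → ℝ := fun τ => (∫⁻ x, potential κ ω x ∂τ).toReal with hLdef
  have hfin : ∀ {K τ}, IsCompact K → K ⊆ A → MemEPlusOn κ K τ →
      ∫⁻ x, potential κ ω x ∂τ ≠ ∞ := fun hK hKA hτ =>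
    lintegral_ne_top_of_isCompact hK (fun x hx => hC x (hKA hx)) hτ
  have hLadd : ∀ {K K' μ ν}, IsCompact K → K ⊆ A → MemEPlusOn κ K μ → IsCompact K' → K' ⊆ A →
      MemEPlusOn κ K' ν → L (μ + ν) = L μ + L ν := fun hK hKA hμ hK' hKA' hν => by
    simp only [hLdef, lintegral_add_measure]
    exact ENNReal.toReal_add (hfin hK hKA hμ) (hfin hK' hKA' hν)
  have hLsmul : ∀ (c : ℝ≥0) μ, L (c • μ) = c * L μ := fun c μ => by
    simp only [hLdef, lintegral_smul_measure, ENNReal.smul_def, smul_eq_mul, ENNReal.toReal_mul,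
      ENNReal.coe_toReal]
  -- Unions of compact sets make this class midpoint convex. The potential bound in it passes to the
  -- limit and gives one half of the desired equality.
  set Γ : Set (Measure X) := {ν | ∃ K, IsCompact K ∧ K ⊆ A ∧ MemEPlusOn κ K ν ∧
    ∀ x, potential κ ν x ≤ potential κ ω x}
  set b : ℝ := ((C : ℝ≥0∞) * (M * ω Set.univ)).toReal
  have hbal : ∀ {K}, IsCompact K → K ⊆ A → ∃ ρ ∈ Γ, pairing κ ρ ρ ≤ b ∧
      ∀ τ, MemEPlusOn κ K τ → gaussFunctional κ L ρ ≤ gaussFunctional κ L τ ∧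
        gaussFunctional κ L ρ = - pairing κ ρ ρ := by
    intro K hK hKA
    obtain ⟨ρ, hρ, heq, hle⟩ := exists_balayage_of_isCompact hκ hK (hω.usc K hK hKA)
      (fun x hx => hC x (hKA hx))
    have hL : ∀ τ, MemEPlusOn κ K τ → L τ = pairing κ ρ τ := fun τ hτ => by
      rw [pairing_eq_lintegral hκ hρ.1 hτ.1, lintegral_congr_ae (heq τ hτ)]
    have hJ : gaussFunctional κ L ρ = - pairing κ ρ ρ := by
      rw [gaussFunctional, hL ρ hρ]; ring
    refine ⟨ρ, ⟨K, hK, hKA, hρ, hle⟩, ?_, fun τ hτ => ⟨?_, hJ⟩⟩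
    · refine ENNReal.toReal_mono ?_
        (energy_le_of_potential_le hκ hM hK (fun x hx => hC x (hKA hx)) hρ hle)
      exact ENNReal.mul_ne_top ENNReal.coe_ne_top
        (ENNReal.mul_ne_top ENNReal.coe_ne_top hω.bounded.ne)
    · rw [hJ, gaussFunctional, hL τ hτ]
      linarith [two_mul_pairing_le hκ hρ.1 hτ.1]
  have hE : ∀ μ ∈ Γ, MemEPlus κ μ := fun μ ⟨_, _, _, hμ, _⟩ => hμ.1
  obtain ⟨τ, ν, hτ, hν, hlim, hmin⟩ := exists_strongTendsto_of_antitone hκ (fun _ => Γ)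
    antitone_const hE
    (by
      rintro - μ ⟨K, hK, hKA, hμ, hμle⟩ ν ⟨K', hK', hKA', hν, hνle⟩
      refine ⟨K ∪ K', hK.union hK', Set.union_subset hKA hKA',
        ((hμ.mono Set.subset_union_left).add hκ (hν.mono Set.subset_union_right)).smul hκ _,
        fun x => ?_⟩
      rw [midpointMeasure, potential_smul, potential_add]
      calc ((2⁻¹ : ℝ≥0) : ℝ≥0∞) * (potential κ μ x + potential κ ν x)
          ≤ 2⁻¹ * (potential κ ω x + potential κ ω x) := by
            rw [ENNReal.coe_inv two_ne_zero, ENNReal.coe_ofNat]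
            gcongr
            exacts [hμle x, hνle x]
        _ = potential κ ω x := by
          rw [← two_mul, ← mul_assoc, ENNReal.inv_mul_cancel two_ne_zero ENNReal.ofNat_ne_top,
            one_mul])
    L
    (by
      rintro μ ⟨K, hK, hKA, hμ, -⟩ ν ⟨K', hK', hKA', hν, -⟩
      rw [midpointMeasure, hLsmul, hLadd hK hKA hμ hK' hKA' hν]
      push_cast
      ring)
    (-b) (gaussFunctional κ L 0)
    (by
      rintro μ ⟨K, hK, hKA, hμ, -⟩
      obtain ⟨ρ, -, hρb, hρ⟩ := hbal hK hKA
      linarith [(hρ μ hμ).1, (hρ μ hμ).2])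
    (fun _ => ⟨0, ⟨∅, isCompact_empty, Set.empty_subset _, MemEPlusOn.zero,
      fun x => by simp [potential]⟩, le_rfl⟩)
  have hτE : ∀ n, MemEPlus κ (τ n) := fun n => hE _ (hτ n)
  have hpair : ∀ σ, MemEPlus κ σ → Tendsto (fun n => pairing κ (τ n) σ) atTop (𝓝 (pairing κ ν σ)) :=
    fun σ hσ => by
      have h := hlim.pairing_left hκ hτE hν hσ
      simpa only [pairing_comm hκ hσ (hτE _), pairing_comm hκ hσ hν] using h
  -- Continuity of `L` along `τ` is not available, so `τ n` is varied instead of `ν`. The measure `τ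
  -- n + sσ` may leave `Γ`, but the balayage `ρ` onto `K' ∪ K` belongs to `Γ` and does no worse; `L
  -- (τ n)` cancels before `n` tends to infinity.
  have hge : ∀ {K σ}, IsCompact K → K ⊆ A → MemEPlusOn κ K σ → L σ ≤ pairing κ ν σ := by
    intro K σ hK hKA hσ
    refine sub_nonneg.1 (nonneg_of_forall_quadratic (pairing_nonneg (κ := κ) σ σ) ?_)
    intro s _ _
    have h1 : ∀ n : ℕ, -(1 / ((n : ℝ) + 1)) ≤
        2 * s * (pairing κ (τ n) σ - L σ) + s ^ 2 * pairing κ σ σ := by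
      intro n
      obtain ⟨K', hK', hKA', hτn, -⟩ := hτ n
      obtain ⟨ρ, hρΓ, -, hρ⟩ := hbal (hK'.union hK) (Set.union_subset hKA' hKA)
      have hs := hσ.smul hκ s
      have h2 := (hρ _ ((hτn.mono Set.subset_union_left).add hκ
        (hs.mono Set.subset_union_right))).1
      have h3 := hmin n ρ hρΓ
      rw [gaussFunctional, gaussFunctional, hLadd hK' hKA' hτn hK hKA hs, hLsmul,
        pairing_add_left hκ hτn.1 hs.1 (hτn.1.add hκ hs.1), pairing_add_right hκ hτn.1 hs.1 hτn.1,
        pairing_add_right hκ hτn.1 hs.1 hs.1, pairing_smul_left hκ s hτn.1,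
        pairing_smul_left hκ s hs.1, pairing_smul_right hκ s hσ.1 hτn.1,
        pairing_smul_right hκ s hσ.1 hσ.1, pairing_comm hκ hσ.1 hτn.1] at h2
      rw [gaussFunctional, gaussFunctional] at h3
      linarith
    have h4 : Tendsto (fun n : ℕ => -(1 / ((n : ℝ) + 1))) atTop (𝓝 (-0)) :=
      tendsto_one_div_add_atTop_nhds_zero_nat.neg
    rw [neg_zero] at h4
    exact le_of_tendsto_of_tendsto' h4 ((((hpair σ hσ.1).sub_const (L σ)).const_mul _).add_const _)
      h1
  have hle : ∀ {K σ}, IsCompact K → K ⊆ A → MemEPlusOn κ K σ → pairing κ ν σ ≤ L σ := by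
    intro K σ hK hKA hσ
    refine le_of_tendsto' (hpair σ hσ.1) fun n => ?_
    obtain ⟨_, _, _, _, hUle⟩ := hτ n
    rw [pairing_eq_lintegral hκ (hτE n) hσ.1]
    exact ENNReal.toReal_mono (hfin hK hKA hσ) (lintegral_mono hUle)
  refine ⟨ν, hν, fun τ K hK hKA hτ => ?_⟩
  have hae1 := ae_le_potential hκ hν (measurable_potential hκ ω) hτ fun σ hσ _ =>
    ⟨hfin hK hKA hσ, hge hK hKA hσ⟩
  have hae2 : ∀ᵐ x ∂τ, potential κ ν x ≤ potential κ ω x := by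
    have := hτ.1.1
    refine ae_le_of_forall_setLIntegral_le_of_sigmaFinite (measurable_potential hκ ν)
      fun s _ _ => ?_
    have hs := hτ.restrict hκ s
    have h := hle hK hKA hs
    rw [pairing_eq_lintegral hκ hν hs.1] at h
    exact (ENNReal.toReal_le_toReal (lintegral_potential_ne_top hκ hν hs.1)
      (hfin hK hKA hs)).1 h
  filter_upwards [hae1, hae2] with x h1 h2 using le_antisymm h2 h1

end BoundedField

/-! ### Approximation of lower semicontinuous functions from below. -/

section Approximation

/-- A lower semicontinuous function with values in `[0, ∞]` is the limit of an increasing sequence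
of nonnegative continuous functions of compact support. -/
theorem exists_monotone_compactSupport {v : X → ℝ≥0∞} (hv : LowerSemicontinuous v) :
    ∃ f : ℕ → X → ℝ, (∀ n, Continuous (f n)) ∧ (∀ n, HasCompactSupport (f n)) ∧
      (∀ n x, 0 ≤ f n x) ∧ Monotone f ∧ ∀ x, ⨆ n, ENNReal.ofReal (f n x) = v x := by
  set 𝓕 : Set (X → ℝ≥0∞) := {g | ∃ φ : X → ℝ, Continuous φ ∧ HasCompactSupport φ ∧
    (∀ x, 0 ≤ φ x) ∧ g = fun x => ENNReal.ofReal (φ x)} ∩ {g | g ≤ v}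
  have hLUB : IsLUB 𝓕 v := by
    refine ⟨fun g hg => hg.2, fun g hg x => ?_⟩
    refine le_of_forall_lt fun r hr => ?_
    obtain ⟨q, hrq, hqv⟩ := exists_between hr
    have hq : q ≠ ∞ := hqv.ne_top
    obtain ⟨φ, hφ1, hφ0, hφc, hφI⟩ := exists_continuous_one_zero_of_isCompact
      (isCompact_singleton (x := x)) (hv.isOpen_preimage q).isClosed_compl
      (Set.disjoint_left.2 fun y hy hy' => hy' (by rw [Set.mem_singleton_iff.1 hy]; exact hqv))
    have hmem : (fun y => ENNReal.ofReal (q.toReal * φ y)) ∈ 𝓕 := by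
      refine ⟨⟨fun y => q.toReal * φ y, by fun_prop, hφc.mul_left,
        fun y => mul_nonneg ENNReal.toReal_nonneg (hφI y).1, rfl⟩, fun y => ?_⟩
      by_cases hy : q < v y
      · calc ENNReal.ofReal (q.toReal * φ y) ≤ ENNReal.ofReal q.toReal :=
              ENNReal.ofReal_le_ofReal
                (mul_le_of_le_one_right ENNReal.toReal_nonneg (hφI y).2)
          _ = q := ENNReal.ofReal_toReal hq
          _ ≤ v y := hy.le
      · have : φ y = 0 := hφ0 hy
        simp [this]
    have h1 : φ x = 1 := hφ1 rfl
    have h := hg hmem x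
    simp only [h1, mul_one, ENNReal.ofReal_toReal hq] at h
    exact hrq.trans_le h
  have h0 : (0 : X → ℝ≥0∞) ∈ 𝓕 :=
    ⟨⟨0, continuous_zero, HasCompactSupport.zero, fun _ => le_rfl, by ext; simp⟩, fun _ => bot_le⟩
  -- Second countability extracts a countable family with the same supremum. Adjoining 0 makes it
  -- nonempty, hence enumerable, and partial suprema make it increasing.
  obtain ⟨𝓕', hsub, hcount, hLUB'⟩ := exists_countable_lowerSemicontinuous_isLUB
    (fun g hg => by
      obtain ⟨⟨φ, hφ, -, -, rfl⟩, -⟩ : g ∈ 𝓕 := hg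
      exact (ENNReal.continuous_ofReal.comp hφ).lowerSemicontinuous) hLUB
  obtain ⟨g, hg⟩ := (hcount.insert 0).exists_eq_range (Set.insert_nonempty _ _)
  have hg𝓕 : ∀ n, g n ∈ 𝓕 := fun n => by
    have : g n ∈ insert 0 𝓕' := hg ▸ Set.mem_range_self n
    rcases this with h | h
    · rw [h]; exact h0
    · exact hsub h
  choose φ hφ hφc hφ0 hgφ using fun n => (hg𝓕 n).1
  have hsucc : ∀ n, partialSups φ (n + 1) = partialSups φ n ⊔ φ (n + 1) := fun n =>
    partialSups_add_one φ n
  have hcont : ∀ n, Continuous (partialSups φ n) := fun n => by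
    induction n with
    | zero => simpa using hφ 0
    | succ n ih => rw [hsucc]; exact ih.sup (hφ _)
  have hnonneg : ∀ n x, 0 ≤ partialSups φ n x := fun n x =>
    (hφ0 n x).trans (le_partialSups φ n x)
  refine ⟨fun n => partialSups φ n, hcont, fun n => ?_, hnonneg, (partialSups φ).monotone,
    fun x => le_antisymm (iSup_le fun n => ?_) ?_⟩
  · induction n with
    | zero => simpa using hφc 0
    | succ n ih =>
      refine HasCompactSupport.intro' (ih.isCompact.union (hφc (n + 1)).isCompact)
        ((isClosed_tsupport _).union (isClosed_tsupport _)) fun x hx => ?_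
      rw [Set.mem_union, not_or] at hx
      beta_reduce at hx ⊢
      rw [hsucc, Pi.sup_apply, image_eq_zero_of_notMem_tsupport hx.1,
        image_eq_zero_of_notMem_tsupport hx.2, sup_idem]
  · have hle : ∀ n, ENNReal.ofReal (φ n x) ≤ v x := fun n => by
      have h := (hg𝓕 n).2 x
      rwa [hgφ n] at h
    induction n with
    | zero => simpa using hle 0
    | succ n ih =>
      beta_reduce
      rw [hsucc, Pi.sup_apply, ENNReal.ofReal_max]
      exact max_le ih (hle _)
  · have hub : v ≤ fun x => ⨆ n, ENNReal.ofReal (partialSups φ n x) := by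
      refine hLUB'.2 fun h hh y => ?_
      obtain ⟨n, rfl⟩ : h ∈ Set.range g := hg ▸ Set.mem_insert_of_mem _ hh
      rw [hgφ n]
      exact le_iSup_of_le n (ENNReal.ofReal_le_ofReal (le_partialSups φ n y))
    exact hub x

end Approximation

/-! ### Quasi-everywhere convergence of decreasing potentials. -/

section Convergence

variable {μ ν σ τ ω : Measure X} {A B E G K : Set X}

theorem outerCap_mono {E F : Set X} (h : E ⊆ F) : outerCap κ E ≤ outerCap κ F :=
  le_iInf fun G => le_iInf fun hG => le_iInf fun hFG =>
    iInf₂_le_of_le G hG (iInf_le _ (h.trans hFG))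

/-- Decreasing sets whose inner capacities are bounded away from zero carry a strongly convergent
sequence of probability measures. -/
theorem exists_strongTendsto_of_lt_innerCap (hκ : IsAdmissibleKernel κ) {G : ℕ → Set X}
    (hG : Antitone G) {δ : ℝ≥0∞} (hδ : 0 < δ) (hcap : ∀ n, δ < innerCap κ (G n)) :
    ∃ (τ : ℕ → Measure X) (σ : Measure X), (∀ n, MemEPlusOn κ (G n) (τ n)) ∧
      (∀ n, τ n Set.univ = 1) ∧ MemEPlus κ σ ∧ StrongTendsto κ τ σ := by
  obtain ⟨τ, σ, hτ, hσ, hlim, -⟩ := exists_strongTendsto_of_antitone hκ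
    (fun n => {μ | MemEPlusOn κ (G n) μ ∧ μ Set.univ = 1})
    (fun m n hmn μ hμ => ⟨hμ.1.mono (hG hmn), hμ.2⟩) (fun μ hμ => hμ.1.1)
    (fun n μ hμ ν hν => ⟨(hμ.1.add hκ hν.1).smul hκ _, by
      simp only [midpointMeasure, Measure.smul_apply, Measure.add_apply, hμ.2, hν.2,
        ENNReal.smul_def, smul_eq_mul, one_add_one_eq_two, ENNReal.coe_inv two_ne_zero,
        ENNReal.coe_ofNat]
      exact ENNReal.inv_mul_cancel two_ne_zero ENNReal.ofNat_ne_top⟩)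
    -- With zero field the functional is the energy; capacities above `δ` provide competitors of
    -- energy below `δ⁻¹`.
    (fun _ => 0) (fun _ _ _ _ => by simp) 0 δ⁻¹.toReal
    (fun μ _ => by simpa [gaussFunctional] using pairing_nonneg μ μ)
    (fun n => by
      obtain ⟨μ, K, hK, hKE, h1, h2, hμ, hlt⟩ := exists_measure_of_lt_innerCap (hcap n)
      refine ⟨μ, ⟨MemEPlusOn.mono ⟨hμ, h2⟩ hKE, h1⟩, ?_⟩
      rw [gaussFunctional, mul_zero, sub_zero]
      exact ENNReal.toReal_mono (ENNReal.inv_ne_top.2 hδ.ne') hlt.le)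
  exact ⟨τ, σ, fun n => (hτ n).1, fun n => (hτ n).2, hσ, hlim⟩

theorem isOpen_lt_of_lowerSemicontinuous {g u : X → ℝ≥0∞} (hg : Continuous g)
    (hu : LowerSemicontinuous u) : IsOpen {x | g x < u x} := by
  refine isOpen_iff_mem_nhds.2 fun x hx => ?_
  obtain ⟨q, hgq, hqu⟩ := exists_between (show g x < u x from hx)
  filter_upwards [hg.continuousAt.eventually (gt_mem_nhds hgq), hu x q hqu] with y h1 h2
  exact lt_trans h1 h2

theorem StrongTendsto.lintegral_potential (hκ : IsAdmissibleKernel κ) {τ : ℕ → Measure X}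
    (hτ : ∀ n, MemEPlus κ (τ n)) (hσ : MemEPlus κ σ) (h : StrongTendsto κ τ σ)
    (hμ : MemEPlus κ μ) : Tendsto (fun n => ∫⁻ x, potential κ μ x ∂(τ n)) atTop
      (𝓝 (∫⁻ x, potential κ μ x ∂σ)) := by
  have h1 := (ENNReal.continuous_ofReal.tendsto _).comp (h.pairing_left hκ hτ hσ hμ)
  have e : ∀ ρ, MemEPlus κ ρ → ENNReal.ofReal (pairing κ μ ρ) = ∫⁻ x, potential κ μ x ∂ρ :=
    fun ρ hρ => by
      rw [pairing_eq_lintegral hκ hμ hρ,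
        ENNReal.ofReal_toReal (lintegral_potential_ne_top hκ hμ hρ)]
  rw [← e σ hσ]
  exact h1.congr fun n => e _ (hτ n)

theorem StrongTendsto.lintegral_potential_left (hκ : IsAdmissibleKernel κ) {μ : ℕ → Measure X}
    (hμ : ∀ n, MemEPlus κ (μ n)) (hν : MemEPlus κ ν) (h : StrongTendsto κ μ ν)
    (hσ : MemEPlus κ σ) : Tendsto (fun n => ∫⁻ x, potential κ (μ n) x ∂σ) atTop
      (𝓝 (∫⁻ x, potential κ ν x ∂σ)) := by
  have h1 := h.lintegral_potential hκ hμ hν hσ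
  have e : ∀ ρ, MemEPlus κ ρ → ∫⁻ x, potential κ σ x ∂ρ = ∫⁻ x, potential κ ρ x ∂σ :=
    fun ρ hρ => by
      have := hσ.1
      have := hρ.1
      rw [← mutualEnergy_eq_lintegral hκ, mutualEnergy_comm hκ, mutualEnergy_eq_lintegral hκ]
  rw [← e ν hν]
  exact h1.congr fun n => e _ (hμ n)

/-- If the capacity were positive, some `σ` of finite energy would satisfy `∫ U^ν dσ + t ≤ ∫ U^ν dσ
< ∞`. -/
theorem outerCap_forall_add_lt_eq_zero (hκ : IsAdmissibleKernel κ) {μ : ℕ → Measure X}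
    (hμ : ∀ n, MemEPlus κ (μ n)) (hν : MemEPlus κ ν) (h : StrongTendsto κ μ ν)
    (hanti : ∀ x, Antitone fun n => potential κ (μ n) x) {t : ℝ≥0∞} (ht : 0 < t) :
    outerCap κ {x | ∀ n, potential κ ν x + t < potential κ (μ n) x} = 0 := by
  by_contra hne
  obtain ⟨δ, hδ, hδE⟩ := exists_between (pos_iff_ne_zero.2 hne)
  obtain ⟨f, hf, hfc, hf0, hfmono, hfsup⟩ :=
    exists_monotone_compactSupport (lowerSemicontinuous_potential hκ ν)
  have hfle : ∀ n x, ENNReal.ofReal (f n x) ≤ potential κ ν x := fun n x =>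
    hfsup x ▸ le_iSup (fun n => ENNReal.ofReal (f n x)) n
  -- Continuous minorants of `U^ν` make these sets open; both sides are monotone in `n`, so they
  -- decrease while containing the exceptional set.
  set G : ℕ → Set X := fun n => {x | ENNReal.ofReal (f n x) + t < potential κ (μ n) x}
  have hGopen : ∀ n, IsOpen (G n) := fun n =>
    isOpen_lt_of_lowerSemicontinuous ((ENNReal.continuous_ofReal.comp (hf n)).add continuous_const)
      (lowerSemicontinuous_potential hκ (μ n))
  have hGanti : Antitone G := fun m n hmn x hx => by
    refine lt_of_le_of_lt ?_ (lt_of_lt_of_le hx (hanti x hmn))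
    gcongr
    exact hfmono hmn x
  have hcap : ∀ n, δ < innerCap κ (G n) := fun n => by
    refine hδE.trans_le (iInf₂_le_of_le (G n) (hGopen n) (iInf_le _ fun x hx => ?_))
    exact lt_of_le_of_lt (by gcongr; exact hfle n x) (hx n)
  obtain ⟨τ, σ, hτ, hτ1, hσ, hτσ⟩ := exists_strongTendsto_of_lt_innerCap hκ hGanti hδ hcap
  have := hσ.1
  have hvague := hκ.consistency.2 τ σ (fun n => (hτ n).1) hσ hτσ
  -- The left integral passes to the limit vaguely, the right one strongly. The summand `t` uses the
  -- unit mass of `τ n`, so loss of mass in `σ` is harmless.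
  have h1 : ∀ j m, ∫⁻ x, ENNReal.ofReal (f m x) ∂σ + t ≤ ∫⁻ x, potential κ (μ j) x ∂σ := by
    intro j m
    have hl := (hvague.lintegral (fun n => (hτ n).1.1) (hf m) (hfc m) (hf0 m)).add_const t
    have hr := hτσ.lintegral_potential hκ (fun n => (hτ n).1) hσ (hμ j)
    refine le_of_tendsto_of_tendsto hl hr ?_
    filter_upwards [eventually_ge_atTop j, eventually_ge_atTop m] with n hj hm
    calc ∫⁻ x, ENNReal.ofReal (f m x) ∂(τ n) + t
        = ∫⁻ x, (ENNReal.ofReal (f m x) + t) ∂(τ n) := by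
          rw [lintegral_add_right _ measurable_const, lintegral_const, hτ1, mul_one]
      _ ≤ ∫⁻ x, potential κ (μ j) x ∂(τ n) := by
        refine lintegral_mono_ae ((hτ n).ae_mem.mono fun x hx => ?_)
        calc ENNReal.ofReal (f m x) + t ≤ ENNReal.ofReal (f n x) + t := by
              gcongr; exact hfmono hm x
          _ ≤ potential κ (μ n) x := le_of_lt hx
          _ ≤ potential κ (μ j) x := hanti x hj
  have h2 : ∀ j, ∫⁻ x, potential κ ν x ∂σ + t ≤ ∫⁻ x, potential κ (μ j) x ∂σ := by
    intro j
    have e : ∫⁻ x, potential κ ν x ∂σ = ⨆ m, ∫⁻ x, ENNReal.ofReal (f m x) ∂σ := by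
      rw [← lintegral_iSup (fun m => ((hf m).measurable.ennreal_ofReal))
        (fun m n hmn x => ENNReal.ofReal_le_ofReal (hfmono hmn x))]
      exact lintegral_congr fun x => (hfsup x).symm
    rw [e, ENNReal.iSup_add]
    exact iSup_le (h1 j)
  have h3 := ge_of_tendsto' (h.lintegral_potential_left hκ hμ hν hσ) h2
  have hfin := lintegral_potential_ne_top hκ hν hσ
  exact absurd h3 (not_le.2 (ENNReal.lt_add_right hfin ht.ne'))

theorem quasiEverywhereOn_tendsto_potential (hκ : IsAdmissibleKernel κ) {μ : ℕ → Measure X}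
    (hμ : ∀ n, MemEPlus κ (μ n)) (hν : MemEPlus κ ν) (h : StrongTendsto κ μ ν)
    (hanti : ∀ x, Antitone fun n => potential κ (μ n) x)
    (hle : ∀ n x, potential κ ν x ≤ potential κ (μ n) x) :
    QuasiEverywhereOn κ Set.univ fun x => (Antitone fun n => potential κ (μ n) x) ∧
      Tendsto (fun n => potential κ (μ n) x) atTop (𝓝 (potential κ ν x)) := by
  have h0 := outerCap_iUnion_eq_zero hκ fun k : ℕ =>
    outerCap_forall_add_lt_eq_zero hκ hμ hν h hanti (t := ((k : ℝ≥0∞) + 1)⁻¹)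
      (ENNReal.inv_pos.2 (by finiteness))
  refine le_antisymm ((outerCap_mono ?_).trans_eq h0) bot_le
  rintro x ⟨-, hx⟩
  by_contra hcon
  simp only [Set.mem_iUnion, Set.mem_ofPred_eq, not_exists, not_forall, not_lt] at hcon
  refine hx ⟨hanti x, ?_⟩
  have hinf : ⨅ n, potential κ (μ n) x = potential κ ν x := by
    refine le_antisymm ?_ (le_iInf fun n => hle n x)
    have hlim : Tendsto (fun k : ℕ => potential κ ν x + ((k : ℝ≥0∞) + 1)⁻¹) atTop
        (𝓝 (potential κ ν x + 0)) := by
      refine Tendsto.add tendsto_const_nhds ?_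
      have := (tendsto_add_atTop_iff_nat 1).2 ENNReal.tendsto_inv_nat_nhds_zero
      simpa using this
    rw [add_zero] at hlim
    refine ge_of_tendsto' hlim fun k => ?_
    obtain ⟨n, hn⟩ := hcon k
    exact iInf_le_of_le n hn
  rw [← hinf]
  exact tendsto_atTop_iInf (hanti x)

end Convergence

/-! ### Characterization, uniqueness and monotone limits of balayages. -/

section InnerBalayage

variable {μ ν σ τ ω ω' : Measure X} {A B : Set X}

/-- `ν` is the balayage of `ω` onto `B` in the sense of test measures from `𝓔⁺(B)`. -/
structure IsBalayage (κ : X → X → ℝ≥0∞) (ω : Measure X) (B : Set X) (ν : Measure X) : Prop where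
  mem : MemEPlusOn κ B ν
  ae_eq : ∀ τ, MemEPlusOn κ B τ → ∀ᵐ x ∂τ, potential κ ν x = potential κ ω x

/-- Measures of finite energy do not charge exceptional sets of zero inner capacity, and such
measures detect positive capacity. This also allows `ω` to be exchanged for `ω'`. -/
theorem isInnerBalayage_iff (hκ : IsAdmissibleKernel κ)
    (hB : ∀ μ, MemEPlus κ μ → NullMeasurableSet B μ)
    (h : ∀ τ, MemEPlusOn κ B τ → ∀ᵐ x ∂τ, potential κ ω' x = potential κ ω x) :
    IsInnerBalayage κ ω B ν ↔ IsBalayage κ ω' B ν := by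
  constructor
  · rintro ⟨hν, hne⟩
    refine ⟨hν, fun τ hτ => ?_⟩
    filter_upwards [h τ hτ, hne.ae hκ (measurableSet_eq_fun (measurable_potential hκ ν)
      (measurable_potential hκ ω)) (hB τ hτ.1) hτ] with x h1 h2 using h2.trans h1.symm
  · rintro ⟨hν, hae⟩
    refine ⟨hν, nearlyEverywhereOn_of_ae fun τ K hK hKB hτ => ?_⟩
    filter_upwards [h τ (hτ.mono hKB), hae τ (hτ.mono hKB)] with x h1 h2 using h2.trans h1

theorem IsBalayage.pairing_eq (hκ : IsAdmissibleKernel κ) (hω : MemEPlus κ ω)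
    (h : IsBalayage κ ω B ν) (hτ : MemEPlusOn κ B τ) : pairing κ ν τ = pairing κ ω τ := by
  rw [pairing_eq_lintegral hκ h.1.1 hτ.1, pairing_eq_lintegral hκ hω hτ.1,
    lintegral_congr_ae (h.2 τ hτ)]

theorem MemEPlusOn.eq_of_pairing_eq (hκ : IsAdmissibleKernel κ) (hμ : MemEPlusOn κ B μ)
    (hν : MemEPlusOn κ B ν) (h : ∀ τ, MemEPlusOn κ B τ → pairing κ μ τ = pairing κ ν τ) :
    μ = ν := by
  refine eq_of_strongDist_sq_eq_zero hκ hμ.1 hν.1 ?_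
  rw [h μ hμ, ← h ν hν, pairing_comm hκ hν.1 hμ.1]
  ring

theorem existsUnique_isBalayage (hκ : IsAdmissibleKernel κ) (hB : IsStronglyClosed κ B)
    (hω : MemEPlus κ ω) : ∃! ν, IsBalayage κ ω B ν := by
  obtain ⟨ν, hν, hae⟩ := exists_balayage hκ hB hω
  have h : IsBalayage κ ω B ν := ⟨hν, hae⟩
  refine ⟨ν, h, fun ν' h' => h'.1.eq_of_pairing_eq hκ hν fun τ hτ => ?_⟩
  rw [h'.pairing_eq hκ hω hτ, h.pairing_eq hκ hω hτ]

theorem IsBalayage.potential_le (hκ : IsAdmissibleKernel κ) (h : IsBalayage κ ω A μ)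
    (h' : IsBalayage κ ω B ν) (hBA : B ⊆ A) (x : X) : potential κ ν x ≤ potential κ μ x := by
  refine hκ.domination ν μ h'.1.1 h.1.1.1 ?_ x
  filter_upwards [h.2 ν (h'.1.mono hBA), h'.2 ν h'.1] with x h1 h2
  exact (h2.trans h1.symm).le

/-- Pythagoras: `I(μ, ν) = I(ω, ν) = I(ν, ν)`, since `ν` is an admissible test measure for both
balayages. -/
theorem IsBalayage.strongDist_sq (hκ : IsAdmissibleKernel κ) (hω : MemEPlus κ ω)
    (h : IsBalayage κ ω A μ) (h' : IsBalayage κ ω B ν) (hBA : B ⊆ A) :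
    strongDist κ μ ν ^ 2 = pairing κ μ μ - pairing κ ν ν := by
  rw [Balayage.strongDist_sq hκ h.1.1 h'.1.1, h.pairing_eq hκ hω (h'.1.mono hBA),
    ← h'.pairing_eq hκ hω h'.1]
  ring

theorem strongDist_comm (hκ : IsAdmissibleKernel κ) (hμ : MemEPlus κ μ) (hν : MemEPlus κ ν) :
    strongDist κ μ ν = strongDist κ ν μ := by
  rw [← sq_eq_sq₀ strongDist_nonneg strongDist_nonneg, strongDist_sq hκ hμ hν,
    strongDist_sq hκ hν hμ, pairing_comm hκ hμ hν]
  ring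

/-- Balayages onto a decreasing sequence of sets converge strongly to the balayage onto the
intersection. -/
theorem strongTendsto_isBalayage (hκ : IsAdmissibleKernel κ) {A : ℕ → Set X} (hA : Antitone A)
    (hcl : ∀ j, IsStronglyClosed κ (A j)) (hω : MemEPlus κ ω) {ωj : ℕ → Measure X}
    (hj : ∀ j, IsBalayage κ ω (A j) (ωj j)) (hν : IsBalayage κ ω (⋂ j, A j) ν) :
    StrongTendsto κ ωj ν := by
  have hE : ∀ j, MemEPlus κ (ωj j) := fun j => (hj j).1.1
  set e : ℕ → ℝ := fun j => pairing κ (ωj j) (ωj j)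
  have hsq : ∀ {j k}, j ≤ k → strongDist κ (ωj j) (ωj k) ^ 2 = e j - e k := fun hjk =>
    (hj _).strongDist_sq hκ hω (hj _) (hA hjk)
  have heanti : Antitone e := fun j k hjk => by
    have := hsq hjk
    nlinarith [sq_nonneg (strongDist κ (ωj j) (ωj k))]
  have helim : Tendsto e atTop (𝓝 (⨅ n, e n)) :=
    tendsto_atTop_ciInf heanti ⟨0, by rintro _ ⟨n, rfl⟩; exact pairing_nonneg _ _⟩
  have heinf : ∀ n, ⨅ n, e n ≤ e n := heanti.le_of_tendsto helim
  have hcauchy : StrongCauchy κ ωj := by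
    intro ε hε
    have hlim : Tendsto (fun n => e n - ⨅ n, e n) atTop (𝓝 0) := by
      simpa using helim.sub_const (⨅ n, e n)
    obtain ⟨N, hN⟩ := (hlim.eventually (gt_mem_nhds (by positivity : 0 < ε ^ 2))).exists
    have key : ∀ m n, N ≤ m → m ≤ n → strongDist κ (ωj m) (ωj n) < ε := fun m n hm hmn => by
      refine lt_of_pow_lt_pow_left₀ 2 hε.le ?_
      rw [hsq hmn]
      linarith [heanti hm, heinf n]
    refine ⟨N, fun m hm n hn => ?_⟩
    rcases le_total m n with h | h
    · exact key m n hm h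
    · rw [strongDist_comm hκ (hE m) (hE n)]
      exact key n m hn h
  obtain ⟨ρ, hρ, hlim⟩ := hκ.consistency.1 ωj hE hcauchy
  -- For each `i`, the shifted sequence starting at index `i` lies in `𝓔⁺(A i)`, which is strongly
  -- closed.
  have hρA : MemEPlusOn κ (⋂ j, A j) ρ := by
    refine ⟨hρ, ?_⟩
    rw [Set.compl_iInter]
    exact measure_iUnion_null fun i => hcl i (fun n => ωj (n + i)) ρ
      (fun n => (hj _).1.mono (hA (Nat.le_add_left i n))) hρ
      ((tendsto_add_atTop_iff_nat i).2 hlim)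
  have hρν : ρ = ν := by
    refine hρA.eq_of_pairing_eq hκ hν.1 fun τ hτ => ?_
    have h1 := hlim.pairing_left hκ hE hρ hτ.1
    have h2 : ∀ j, pairing κ τ (ωj j) = pairing κ ω τ := fun j => by
      rw [pairing_comm hκ hτ.1 (hE j),
        (hj j).pairing_eq hκ hω (hτ.mono (Set.iInter_subset _ j))]
    simp only [h2] at h1
    rw [pairing_comm hκ hρ hτ.1, hν.pairing_eq hκ hω hτ]
    exact tendsto_nhds_unique h1 tendsto_const_nhds
  rwa [← hρν]

/-- On `A` the potential `U^ω` agrees with the potential of some measure of finite energy. -/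
theorem exists_memEPlus_of_field (hκ : IsAdmissibleKernel κ) (hA : IsQuasiclosed κ A)
    [IsLocallyFiniteMeasure ω] (hω : MemEPlus κ ω ∨ BoundedFieldOn κ ω A) :
    ∃ ω', MemEPlus κ ω' ∧
      ∀ τ, MemEPlusOn κ A τ → ∀ᵐ x ∂τ, potential κ ω' x = potential κ ω x := by
  rcases hω with hω | hω
  · exact ⟨ω, hω, fun _ _ => Eventually.of_forall fun _ => rfl⟩
  · obtain ⟨ω', hω', h⟩ := hω.exists_memEPlus hκ
    exact ⟨ω', hω', fun τ hτ => (nearlyEverywhereOn_of_ae h).ae hκ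
      (measurableSet_eq_fun (measurable_potential hκ ω') (measurable_potential hκ ω))
      (hA.nullMeasurableSet hκ hτ.1) hτ⟩

end InnerBalayage

end Balayage

theorem mainTheorem9 {X : Type*} [TopologicalSpace X] [T2Space X] [LocallyCompactSpace X]
    [SecondCountableTopology X] [MeasurableSpace X] [BorelSpace X]
    (κ : X → X → ℝ≥0∞) (hκ : Balayage.IsAdmissibleKernel κ)
    (A : ℕ → Set X) (hA_anti : Antitone A)
    (hA_qc : ∀ j, Balayage.IsQuasiclosed κ (A j))
    (hA_cap : 0 < Balayage.innerCap κ (⋂ j, A j))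
    (ω : Measure X) [IsLocallyFiniteMeasure ω] (hω0 : ω ≠ 0)
    (hω : Balayage.MemEPlus κ ω ∨ Balayage.BoundedFieldOn κ ω (A 0)) :
    (∀ j, ∃! ν : Measure X, Balayage.IsInnerBalayage κ ω (A j) ν) ∧
    (∃! ν : Measure X, Balayage.IsInnerBalayage κ ω (⋂ j, A j) ν) ∧
    ∀ (ωj : ℕ → Measure X) (ωA : Measure X),
      (∀ j, Balayage.IsInnerBalayage κ ω (A j) (ωj j)) →
      Balayage.IsInnerBalayage κ ω (⋂ j, A j) ωA →
      Balayage.StrongTendsto κ ωj ωA ∧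
      Balayage.VagueTendsto ωj ωA ∧
      Balayage.QuasiEverywhereOn κ Set.univ (fun x =>
        Antitone (fun j => Balayage.potential κ (ωj j) x) ∧
        Tendsto (fun j => Balayage.potential κ (ωj j) x) atTop
          (𝓝 (Balayage.potential κ ωA x))) := by
  -- A single `ω'` constructed on the largest set serves all smaller sets and the intersection.
  obtain ⟨ω', hω', hae⟩ := Balayage.exists_memEPlus_of_field hκ (hA_qc 0) hω
  have hcl : ∀ j, Balayage.IsStronglyClosed κ (A j) := fun j => (hA_qc j).isStronglyClosed hκ
  have hiff : ∀ j ν, Balayage.IsInnerBalayage κ ω (A j) ν ↔ Balayage.IsBalayage κ ω' (A j) ν :=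
    fun j ν => Balayage.isInnerBalayage_iff hκ (fun μ hμ => (hA_qc j).nullMeasurableSet hκ hμ)
      fun τ hτ => hae τ (hτ.mono (hA_anti (Nat.zero_le j)))
  have hiff' : ∀ ν, Balayage.IsInnerBalayage κ ω (⋂ j, A j) ν ↔
      Balayage.IsBalayage κ ω' (⋂ j, A j) ν := fun ν =>
    Balayage.isInnerBalayage_iff hκ
      (fun μ hμ => NullMeasurableSet.iInter fun j => (hA_qc j).nullMeasurableSet hκ hμ)
      fun τ hτ => hae τ (hτ.mono (Set.iInter_subset _ 0))
  simp only [hiff, hiff']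
  refine ⟨fun j => Balayage.existsUnique_isBalayage hκ (hcl j) hω',
    Balayage.existsUnique_isBalayage hκ (Balayage.IsStronglyClosed.iInter hcl) hω',
    fun ωj ωA hj hωA => ?_⟩
  have hstrong := Balayage.strongTendsto_isBalayage hκ hA_anti hcl hω' hj hωA
  exact ⟨hstrong, hκ.consistency.2 ωj ωA (fun j => (hj j).1.1) hωA.1.1 hstrong,
    Balayage.quasiEverywhereOn_tendsto_potential hκ (fun j => (hj j).1.1) hωA.1.1 hstrong
      (fun x j k hjk => (hj j).potential_le hκ (hj k) (hA_anti hjk) x)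
      (fun j x => (hj j).potential_le hκ hωA (Set.iInter_subset _ j) x)⟩
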